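/- **Model.** Let $H\in\{0,1\}$ be a random hypothesis with $p(H_i)=P(H=i)>0$, let $\Theta$ be a real random parameter with $E[\Theta^2]<\infty$ which under $H_i$ takes values in a convex set $\Lambda_i\subseteq\mathbb R$ almost surely, and let $X_1,\dots,X_N$ be observations which, given $(H,\Theta)=(i,\theta)$, are i.i.d. with law $p(\cdot\,|\,\theta)$. Let $t_n$ be a sufficient statistic: $t_0$ is fixed, $t_{n+1}=\xi(t_n,X_{n+1})$, and the conditional law of $\Theta$ given $X_1,\dots,X_n$ is its conditional law given $t_n$, for all $n\le N$. **Policies.** A feasible policy $\pi=(\Psi_n,\delta_n,\hat\theta_{0,n},\hat\theta_{1,n})_{0\le n\le N}$ consists of measurable functions of $(X_1,\dots,X_n)$ with values in $\{0,1\}$, $\{0,1\}$, $\Lambda_0$, $\Lambda_1$, with $\Psi_N=1$. Its run-length is $\tau=\min\{n:\Psi_n=1\}$. For weights $C=(C_0,C_1,C_2,C_3)\ge 0$ the unconstrained problem is to minimize, over feasible policies, $$E\Big[\tau+\mathbf 1\{\delta_\tau\ne H\}\,C_H+\mathbf 1\{\delta_\tau=H\}\,C_{H+2}\,(\Theta-\hat\theta_{H,\tau})^2\Big].$$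 An *optimal policy for $C$* is a minimizer whose estimators are the posterior means $\hat\theta_{i,n}=E[\Theta\,|\,X_1,\dots,X_n,H_i]$, for all $n\le N$, almost surely under $H_i$. For $\gamma_0,\gamma_1\in(0,1)$ and $\gamma_2,\gamma_3\in(0,\infty)$ the constrained problem is to minimize $E[\tau]$ over feasible policies subject to $$P(\delta_\tau=1-i\,|\,H_i)\le\gamma_i,\qquad E\big[\mathbf 1\{\delta_\tau=i\}(\hat\theta_{i,\tau}-\Theta)^2\,\big|\,H_i\big]\le\gamma_{2+i},\qquad i=0,1.$$ **Cost functions and dual objective.** Put $$D_{i,n}(t)=C_{1-i}\,p(H_{1-i}|t_n=t)+C_{2+i}\,p(H_i|t_n=t)\operatorname{Var}[\Theta\,|\,t_n=t,H_i],\qquad g_n=\min\{D_{0,n},D_{1,n}\},$$ $$\rho_N=g_N,\qquad d_n(t)=1+\int\rho_{n+1}(\xi(t,x))\,p(dx\,|\,t_n=t),\qquad \rho_n=\min\{g_n,d_n\}\quad(n<N),$$ where $p(dx\,|\,t_n=t)=\int p(dx\,|\,\theta)\,p(d\theta\,|\,t_n=t)$ is the posterior predictive law, and $$L_\gamma(C)=\rho_0(t_0)-\sum_{i=0}^1p(H_i)\,C_i\gamma_i-\sum_{i=2}^3p(H_{i-2})\,C_i\gamma_i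 .$$ **Theorem.** Let $C^\star$ maximize $L_\gamma$ over $C\ge0$, and suppose that for $C=C^\star$ ties have probability zero along the run of the optimal test, that is: with probability one, for every $n\le N$ such that $d_k(t_k)<g_k(t_k)$ for all $k<n$, one has $g_n(t_n)\neq d_n(t_n)$ if $n<N$, and $D_{0,n}(t_n)\ne D_{1,n}(t_n)$ if $n=N$ or $g_n(t_n)<d_n(t_n)$. Then: 1. An optimal policy for $C^\star$ exists. 2. Every optimal policy $\pi^\star$ for $C^\star$ solves the constrained problem, and $L_\gamma(C^\star)=E[\tau(\pi^\star)]$. 3. Conversely, every solution $\pi$ of the constrained problem minimizes the unconstrained objective with weights $C^\star$ and agrees with every optimal policy $\pi^\star$ for $C^\star$: almost surely the two have the same $\tau$ and the same $\delta_\tau$, and for each $i$ with $C^\star_{2+i}>0$ the same estimate $\hat\theta_{i,\tau}$ almost surely under $H_i$ on $\{\delta_\tau=i\}$. -/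

import Mathlib

open MeasureTheory ProbabilityTheory

noncomputable section

namespace SeqJoint

/-- The statistic `t_n` after the observations `x 0, …, x (n - 1)`. -/
def statRec {𝒳 T : Type*} (ξ : T → 𝒳 → T) (t₀ : T) (x : ℕ → 𝒳) : ℕ → T
  | 0 => t₀
  | n + 1 => ξ (statRec ξ t₀ x n) (x n)

/-- A Bayesian sequential joint detection and estimation model with horizon `N`, on a probability
space `(Ω, P)`. The observations `X_1, …, X_N` are `X 0, …, X (N - 1)`; later terms of the sequence
`X` are irrelevant. -/
structure Model {Ω : Type*} [MeasurableSpace Ω] (P : Measure Ω)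
    (𝒳 : Type*) [MeasurableSpace 𝒳] (T : Type*) [MeasurableSpace T] where
  /-- the maximal number of observations -/
  N : ℕ
  /-- the true hypothesis -/
  H : Ω → Fin 2
  /-- the random parameter -/
  Θ : Ω → ℝ
  /-- the observations -/
  X : ℕ → Ω → 𝒳
  /-- the likelihood `p(x | θ)`, as a family of probability measures -/
  lik : Kernel ℝ 𝒳
  /-- the parameter spaces under the two hypotheses -/
  Λ : Fin 2 → Set ℝ
  /-- the initial value of the sufficient statistic -/
  t₀ : T
  /-- the update of the sufficient statistic -/
  ξ : T → 𝒳 → T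
  measurable_H : Measurable H
  measurable_Θ : Measurable Θ
  measurable_X : ∀ k, Measurable (X k)
  markov_lik : IsMarkovKernel lik
  measurable_ξ : Measurable (Function.uncurry ξ)
  /-- both hypotheses have positive prior probability -/
  prior_pos : ∀ i, 0 < P (H ⁻¹' {i})
  convex_Λ : ∀ i, Convex ℝ (Λ i)
  Θ_mem : ∀ᵐ ω ∂P, Θ ω ∈ Λ (H ω)
  /-- the second moment of the parameter is finite -/
  memLp_Θ : MemLp Θ 2 P
  /-- given `(H, Θ)`, the observations are i.i.d. with law `p(x | Θ)` -/
  factorization : ∀ (A : Set (Fin 2 × ℝ)) (B : ℕ → Set 𝒳), MeasurableSet A →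
    (∀ k, MeasurableSet (B k)) →
    P {ω | (H ω, Θ ω) ∈ A ∧ ∀ k < N, X k ω ∈ B k} =
      ∫⁻ ω in {ω | (H ω, Θ ω) ∈ A}, ∏ k ∈ Finset.range N, lik (Θ ω) (B k) ∂P
  /-- sufficiency: for `n ≤ N`, the posterior of the parameter given `X_1, …, X_n` is its posterior
  given the statistic `t_n`, where `t_{n+1} = ξ (t_n, x_{n+1})` -/
  sufficient : ∀ n ≤ N, ∀ A : Set ℝ, MeasurableSet A →
    P[(Θ ⁻¹' A).indicator (fun _ => (1 : ℝ)) |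
        MeasurableSpace.comap (fun ω (k : Fin n) => X k ω) inferInstance] =ᵐ[P]
      P[(Θ ⁻¹' A).indicator (fun _ => (1 : ℝ)) |
        MeasurableSpace.comap (fun ω => statRec ξ t₀ (fun k => X k ω) n) inferInstance]

/-- A non-randomized policy: stopping rule, decision rule and one estimator per hypothesis; at time
`n` each of them is a function of the first `n` observations. -/
structure Policy (𝒳 : Type*) where
  halt : (n : ℕ) → (Fin n → 𝒳) → Bool
  dec : (n : ℕ) → (Fin n → 𝒳) → Fin 2
  est : Fin 2 → (n : ℕ) → (Fin n → 𝒳) → ℝ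

/-- The index of the detection weight `C_i`, `i = 0, 1`. -/
def det (i : Fin 2) : Fin 4 := Fin.castAdd 2 i

/-- The index of the estimation weight `C_{2+i}`, `i = 0, 1`. -/
def mse (i : Fin 2) : Fin 4 := Fin.natAdd 2 i

/-- The joint loss of deciding for `d` with estimates `e` when the truth is `(h, θ)`. -/
def jointLoss (C : Fin 4 → ℝ) (d : Fin 2) (e : Fin 2 → ℝ) (h : Fin 2) (θ : ℝ) : ℝ :=
  if d = h then C (mse h) * (θ - e h) ^ 2 else C (det h)

namespace Model

variable {Ω : Type*} [MeasurableSpace Ω] {P : Measure Ω}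
  {𝒳 : Type*} [MeasurableSpace 𝒳] {T : Type*} [MeasurableSpace T]

/-- The first `n` observations. -/
def obs (M : Model P 𝒳 T) (n : ℕ) (ω : Ω) : Fin n → 𝒳 := fun k => M.X k ω

/-- The sufficient statistic `t_n` as a random variable. -/
def stat (M : Model P 𝒳 T) (n : ℕ) (ω : Ω) : T := statRec M.ξ M.t₀ (fun k => M.X k ω) n

/-- The prior probability `p(H_i)`. -/
def prior (M : Model P 𝒳 T) (i : Fin 2) : ℝ := P.real (M.H ⁻¹' {i})

/-- The conditional probability measure `P(· | H_i)`. -/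
def condH (M : Model P 𝒳 T) (i : Fin 2) : Measure Ω := ProbabilityTheory.cond P (M.H ⁻¹' {i})

/-! ### Policies and their performance -/

/-- The set of feasible policies; the policy has to stop at time `N` at the latest. -/
structure Feasible (M : Model P 𝒳 T) (π : Policy 𝒳) : Prop where
  measurable_halt : ∀ n ≤ M.N, Measurable (π.halt n)
  measurable_dec : ∀ n ≤ M.N, Measurable (π.dec n)
  measurable_est : ∀ i, ∀ n ≤ M.N, Measurable (π.est i n)
  est_mem : ∀ i, ∀ n ≤ M.N, ∀ x, π.est i n x ∈ M.Λ i
  halt_last : ∀ x, π.halt M.N x = true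

/-- The run-length `τ`. -/
def runLength (M : Model P 𝒳 T) (π : Policy 𝒳) (ω : Ω) : ℕ :=
  sInf {n | π.halt n (M.obs n ω) = true}

/-- The final decision `δ_τ`. -/
def finalDec (M : Model P 𝒳 T) (π : Policy 𝒳) (ω : Ω) : Fin 2 :=
  π.dec (M.runLength π ω) (M.obs _ ω)

/-- The final estimate under hypothesis `i`. -/
def finalEst (M : Model P 𝒳 T) (π : Policy 𝒳) (i : Fin 2) (ω : Ω) : ℝ :=
  π.est i (M.runLength π ω) (M.obs _ ω)

/-- The expected run-length `E[τ]`. -/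
def expRunLength (M : Model P 𝒳 T) (π : Policy 𝒳) : ℝ := ∫ ω, (M.runLength π ω : ℝ) ∂P

/-- The error probability `p(δ_τ = 1 - i | H_i)`. -/
def errProb (M : Model P 𝒳 T) (π : Policy 𝒳) (i : Fin 2) : ENNReal :=
  M.condH i {ω | M.finalDec π ω = 1 - i}

/-- The mean squared error `E[1{δ_τ = i} (θ̂_{i,τ} - θ)² | H_i]`, possibly infinite. -/
def estErr (M : Model P 𝒳 T) (π : Policy 𝒳) (i : Fin 2) : ENNReal :=
  ∫⁻ ω in {ω | M.finalDec π ω = i},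
    ENNReal.ofReal ((M.finalEst π i ω - M.Θ ω) ^ 2) ∂(M.condH i)

/-- The weighted objective: expected run-length plus expected loss, possibly infinite. -/
def objective (M : Model P 𝒳 T) (C : Fin 4 → ℝ) (π : Policy 𝒳) : ENNReal :=
  ∫⁻ ω, ENNReal.ofReal ((M.runLength π ω : ℝ) +
    jointLoss C (M.finalDec π ω) (fun i => M.finalEst π i ω) (M.H ω) (M.Θ ω)) ∂P

/-- `π` minimizes the weighted objective over all feasible policies. -/
def Minimizes (M : Model P 𝒳 T) (C : Fin 4 → ℝ) (π : Policy 𝒳) : Prop :=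
  M.Feasible π ∧ ∀ π', M.Feasible π' → M.objective C π ≤ M.objective C π'

/-- The estimators of `π` are the posterior means `E[Θ | X_1, …, X_n, H_i]`. -/
def UsesPosteriorMeans (M : Model P 𝒳 T) (π : Policy 𝒳) : Prop :=
  ∀ i, ∀ n ≤ M.N, (fun ω => π.est i n (M.obs n ω)) =ᵐ[M.condH i]
    condExp (MeasurableSpace.comap (M.obs n) inferInstance) (M.condH i) M.Θ

/-- `π` is an optimal policy for the unconstrained problem with weights `C`. If an estimation weight
vanishes the objective does not see the corresponding estimator; it is the posterior mean in any
case. -/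
def IsOptimalPolicy (M : Model P 𝒳 T) (C : Fin 4 → ℝ) (π : Policy 𝒳) : Prop :=
  M.Minimizes C π ∧ M.UsesPosteriorMeans π

/-- The constraints on the two error probabilities and the two mean squared errors. -/
def MeetsConstraints (M : Model P 𝒳 T) (γ : Fin 4 → ℝ) (π : Policy 𝒳) : Prop :=
  ∀ i, M.errProb π i ≤ ENNReal.ofReal (γ (det i)) ∧ M.estErr π i ≤ ENNReal.ofReal (γ (mse i))

/-- `π` solves the constrained problem. -/
def SolvesConstrained (M : Model P 𝒳 T) (γ : Fin 4 → ℝ) (π : Policy 𝒳) : Prop :=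
  M.Feasible π ∧ M.MeetsConstraints γ π ∧
    ∀ π', M.Feasible π' → M.MeetsConstraints γ π' → M.expRunLength π ≤ M.expRunLength π'

/-! ### The cost functions -/

section Bellman

variable [IsFiniteMeasure P]

/-- The joint posterior of `(H, Θ)` given `t_n`. -/
def posterior (M : Model P 𝒳 T) (n : ℕ) : Kernel T (Fin 2 × ℝ) :=
  condDistrib (fun ω => (M.H ω, M.Θ ω)) (M.stat n) P

/-- The posterior probability `p(H_i | t_n = t)`. -/
def postProb (M : Model P 𝒳 T) (n : ℕ) (i : Fin 2) (t : T) : ℝ :=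
  (M.posterior n t).real {y | y.1 = i}

/-- The posterior variance `Var[Θ | t_n = t, H_i]`. -/
def postVar (M : Model P 𝒳 T) (n : ℕ) (i : Fin 2) (t : T) : ℝ :=
  variance (fun y : Fin 2 × ℝ => y.2) (ProbabilityTheory.cond (M.posterior n t) {y | y.1 = i})

/-- The posterior predictive law `p(x_{n+1} | t_n) = ∫ p(x_{n+1} | θ) p(θ | t_n) dθ`. -/
def predictive (M : Model P 𝒳 T) (n : ℕ) : Kernel T 𝒳 :=
  M.lik.comp (M.posterior n).snd

/-- The cost `D_{i,n}` of stopping at time `n` and deciding for hypothesis `i`. -/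
def decCost (M : Model P 𝒳 T) (C : Fin 4 → ℝ) (n : ℕ) (i : Fin 2) (t : T) : ℝ :=
  C (det (1 - i)) * M.postProb n (1 - i) t + C (mse i) * M.postProb n i t * M.postVar n i t

/-- The cost `g` of stopping at time `n`. -/
def stopCost (M : Model P 𝒳 T) (C : Fin 4 → ℝ) (n : ℕ) (t : T) : ℝ :=
  min (M.decCost C n 0 t) (M.decCost C n 1 t)

/-- The optimal cost at time `n` if at most `m` further observations are available. -/
def rhoAux (M : Model P 𝒳 T) (C : Fin 4 → ℝ) : ℕ → ℕ → T → ℝ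
  | 0, n, t => M.stopCost C n t
  | m + 1, n, t =>
      min (M.stopCost C n t) (1 + ∫ x, M.rhoAux C m (n + 1) (M.ξ t x) ∂(M.predictive n t))

/-- The cost function `ρ_n`, for `n ≤ N`. -/
def rho (M : Model P 𝒳 T) (C : Fin 4 → ℝ) (n : ℕ) (t : T) : ℝ := M.rhoAux C (M.N - n) n t

/-- The cost `d_n` of continuing at time `n`, for `n < N`. -/
def contCost (M : Model P 𝒳 T) (C : Fin 4 → ℝ) (n : ℕ) (t : T) : ℝ :=
  1 + ∫ x, M.rho C (n + 1) (M.ξ t x) ∂(M.predictive n t)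

theorem rho_last (M : Model P 𝒳 T) (C : Fin 4 → ℝ) (t : T) :
    M.rho C M.N t = M.stopCost C M.N t := by
  simp [rho, rhoAux]

theorem rho_of_lt (M : Model P 𝒳 T) (C : Fin 4 → ℝ) {n : ℕ} (hn : n < M.N) (t : T) :
    M.rho C n t = min (M.stopCost C n t) (M.contCost C n t) := by
  obtain ⟨m, hm⟩ : ∃ m, M.N - n = m + 1 := ⟨M.N - n - 1, by omega⟩
  have hm' : M.N - (n + 1) = m := by omega
  simp [rho, contCost, hm, hm', rhoAux]

/-- The dual objective `L_γ(C)`. -/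
def dual (M : Model P 𝒳 T) (γ C : Fin 4 → ℝ) : ℝ :=
  M.rho C 0 M.t₀ - ∑ i : Fin 2, M.prior i * C (det i) * γ (det i)
    - ∑ i : Fin 2, M.prior i * C (mse i) * γ (mse i)

/-- With probability one the optimal procedure for the weights `C` meets no tie: as long as it runs,
the costs of stopping and continuing differ, and when it stops the costs of the two decisions
differ. -/
def NoTies (M : Model P 𝒳 T) (C : Fin 4 → ℝ) : Prop :=
  ∀ᵐ ω ∂P, ∀ n ≤ M.N,
    (∀ k < n, M.contCost C k (M.stat k ω) < M.stopCost C k (M.stat k ω)) →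
      (n < M.N → M.stopCost C n (M.stat n ω) ≠ M.contCost C n (M.stat n ω)) ∧
      ((n = M.N ∨ M.stopCost C n (M.stat n ω) < M.contCost C n (M.stat n ω)) →
        M.decCost C n 0 (M.stat n ω) ≠ M.decCost C n 1 (M.stat n ω))

end Bellman

/-- Two policies agree, with respect to the weights `C`: almost surely they have the same run-length
and final decision, and for each `i` with a positive estimation weight they give the same estimate
whenever `H_i` is true and is decided for. -/
def Agree (M : Model P 𝒳 T) (C : Fin 4 → ℝ) (π π' : Policy 𝒳) : Prop :=
  (∀ᵐ ω ∂P, M.runLength π ω = M.runLength π' ω ∧ M.finalDec π ω = M.finalDec π' ω) ∧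
  ∀ i, 0 < C (mse i) →
    ∀ᵐ ω ∂(M.condH i), M.finalDec π ω = i → M.finalEst π i ω = M.finalEst π' i ω

end Model

end SeqJoint

end

noncomputable section

namespace SeqJoint

/-! The argument is Lagrangian duality for an optimal stopping problem. For a fixed policy the
unconstrained objective is affine in the weights: it is `E[τ] + ∑ p_j C_j e_j`, where `e` collects
the two error probabilities and the two mean squared errors (`objective_eq_sum`). Since `ρ_0(t_0)`
is its minimum over policies, the errors of an optimal policy minus `γ` give a supergradient of
`L_γ`, up to the factors `p_j` (`sum_sub_mul_le_dual_sub`).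

That `ρ_0(t_0)` is the minimum follows from an exact identity (`objective_eq`): the objective equals
`ρ_0(t_0)` plus nonnegative excesses, charged for stopping or continuing when the other is cheaper,
for taking the dearer decision, and for an estimate off the posterior mean. The dynamic programming
policy has no excess. Conversely a minimizer has none, and without ties this determines `τ` and
`δ_τ` almost surely (`Minimizes.ae_followsOptimal`, `FollowsOptimal.eq`). The identity needs the
laws of `(H, Θ)` and of the next observation, given the past, to be functions of `t_n`
(`compProd_posterior`, `compProd_predictive`). Sufficiency is assumed for `Θ` alone; it extends to
the pair because the observations depend on `H` only through `Θ`.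

The optimality conditions at a maximizer `C` come from moving one weight to `C_j + sδ`. The
supergradient inequality at the perturbed point, combined with maximality of `C`, gives `s (e_j -
γ_j) ≤ 0` for the errors of the perturbed optimal policy. As `δ → 0` these errors converge to those
at `C`: without ties at `C` the optimal run is cut out by finitely many strict inequalities, which
persist for nearby weights, and the estimators do not depend on the weights (`tendsto_errVec`). Ties
at the perturbed weights are harmless. Then `s = 1` gives the constraints and `s = -C_j`
complementary slackness, hence `L_γ(C) = E[τ]`. With weak duality this solves the constrained
problem, and any other solution has Lagrangian at most `ρ_0(t_0)`, so it is a minimizer and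
uniqueness applies. -/

/-- The statistic as a function of the first `n` observations. -/
def statFin {𝒳 T : Type*} (ξ : T → 𝒳 → T) (t₀ : T) : (n : ℕ) → (Fin n → 𝒳) → T
  | 0, _ => t₀
  | n + 1, x => ξ (statFin ξ t₀ n (fun k => x k.castSucc)) (x (Fin.last n))

/-! ### Observations, the statistic and probabilities of boxes -/

namespace Model

variable {Ω : Type*} [MeasurableSpace Ω] {P : Measure Ω}
  {𝒳 : Type*} [MeasurableSpace 𝒳] {T : Type*} [MeasurableSpace T]

/-- The pair `(H, Θ)`. -/
def state (M : Model P 𝒳 T) (ω : Ω) : Fin 2 × ℝ := (M.H ω, M.Θ ω)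

/-- The statistic `t_n` as a function of the first `n` observations. -/
def statOf (M : Model P 𝒳 T) (n : ℕ) : (Fin n → 𝒳) → T := statFin M.ξ M.t₀ n

instance (M : Model P 𝒳 T) : IsMarkovKernel M.lik := M.markov_lik

theorem measurable_state (M : Model P 𝒳 T) : Measurable M.state :=
  M.measurable_H.prodMk M.measurable_Θ

theorem measurable_obs (M : Model P 𝒳 T) (n : ℕ) : Measurable (M.obs n) :=
  measurable_pi_lambda _ fun k => M.measurable_X k

theorem statOf_obs (M : Model P 𝒳 T) (n : ℕ) (ω : Ω) : M.statOf n (M.obs n ω) = M.stat n ω := by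
  induction n with
  | zero => rfl
  | succ n ih =>
    change M.ξ (M.statOf n (M.obs n ω)) (M.X n ω) = _
    rw [ih]
    rfl

theorem stat_succ (M : Model P 𝒳 T) (n : ℕ) (ω : Ω) :
    M.stat (n + 1) ω = M.ξ (M.stat n ω) (M.X n ω) := rfl

theorem measurable_statOf (M : Model P 𝒳 T) (n : ℕ) : Measurable (M.statOf n) := by
  induction n with
  | zero => exact measurable_const
  | succ n ih =>
    change Measurable fun x : Fin (n + 1) → 𝒳 =>
      Function.uncurry M.ξ (M.statOf n (fun k => x k.castSucc), x (Fin.last n))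
    exact M.measurable_ξ.comp ((ih.comp (by fun_prop)).prodMk (by fun_prop))

theorem measurable_stat (M : Model P 𝒳 T) (n : ℕ) : Measurable (M.stat n) := by
  have : M.stat n = M.statOf n ∘ M.obs n := funext fun ω => (M.statOf_obs n ω).symm
  rw [this]
  exact (M.measurable_statOf n).comp (M.measurable_obs n)

/-- The observations fall in the box `B`. -/
def box (M : Model P 𝒳 T) {n : ℕ} (B : Fin n → Set 𝒳) : Set Ω :=
  M.obs n ⁻¹' Set.univ.pi B

/-- The likelihood of a box. -/
def boxLik (M : Model P 𝒳 T) {n : ℕ} (B : Fin n → Set 𝒳) (θ : ℝ) : ENNReal :=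
  ∏ k, M.lik θ (B k)

theorem measurable_boxLik (M : Model P 𝒳 T) {n : ℕ} {B : Fin n → Set 𝒳}
    (hB : ∀ k, MeasurableSet (B k)) : Measurable (M.boxLik B) :=
  Finset.measurable_fun_prod _ fun k _ => M.lik.measurable_coe (hB k)

/-- The factorization applied to the box padded by `Set.univ` up to the horizon; the padding
contributes factors `1` because the likelihood is a Markov kernel. -/
theorem measure_box_inter (M : Model P 𝒳 T) {n : ℕ} (hn : n ≤ M.N) {B : Fin n → Set 𝒳}
    (hB : ∀ k, MeasurableSet (B k)) {A : Set (Fin 2 × ℝ)} (hA : MeasurableSet A) :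
    P (M.state ⁻¹' A ∩ M.box B) = ∫⁻ ω in M.state ⁻¹' A, M.boxLik B (M.Θ ω) ∂P := by
  have h := M.factorization A (fun k => if h : k < n then B ⟨k, h⟩ else Set.univ) hA
    (fun k => by split_ifs <;> simp [hB])
  convert h using 2
  · ext ω
    simp only [Set.mem_inter_iff, Set.mem_preimage, state, box, obs, Set.mem_pi, Set.mem_univ,
      true_imp_iff, Set.mem_ofPred_eq]
    refine and_congr_right fun _ => ⟨fun h k _ => ?_, fun h k => ?_⟩
    · split_ifs with hk
      · exact h ⟨k, hk⟩
      · trivial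
    · simpa using h k (k.2.trans_le hn)
  · rfl
  · funext ω
    change ∏ k, M.lik (M.Θ ω) (B k) = _
    rw [Finset.prod_fin_eq_prod_range, ← Finset.prod_range_mul_prod_Ico _ hn]
    have h2 : ∏ k ∈ Finset.Ico n M.N,
        M.lik (M.Θ ω) (if h : k < n then B ⟨k, h⟩ else Set.univ) = 1 :=
      Finset.prod_eq_one fun k hk => by
        simp [not_lt.2 (Finset.mem_Ico.1 hk).1]
    rw [h2, mul_one]
    refine Finset.prod_congr rfl fun k hk => ?_
    simp [Finset.mem_range.1 hk]

/-- Restricting to a box reweights the law of `(H, Θ)` by the density `boxLik`. -/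
theorem setLIntegral_box (M : Model P 𝒳 T) {n : ℕ} (hn : n ≤ M.N) {B : Fin n → Set 𝒳}
    (hB : ∀ k, MeasurableSet (B k)) {f : Fin 2 × ℝ → ENNReal} (hf : Measurable f) :
    ∫⁻ ω in M.box B, f (M.state ω) ∂P = ∫⁻ ω, M.boxLik B (M.Θ ω) * f (M.state ω) ∂P := by
  have hw : Measurable fun y : Fin 2 × ℝ => M.boxLik B y.2 :=
    (M.measurable_boxLik hB).comp measurable_snd
  have key : (P.restrict (M.box B)).map M.state
      = (P.map M.state).withDensity (fun y => M.boxLik B y.2) := by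
    ext A hA
    rw [Measure.map_apply M.measurable_state hA, withDensity_apply _ hA,
      setLIntegral_map hA hw M.measurable_state,
      Measure.restrict_apply (M.measurable_state hA), M.measure_box_inter hn hB hA]
    rfl
  rw [← lintegral_map hf M.measurable_state, key, lintegral_withDensity_eq_lintegral_mul _ hw hf,
    lintegral_map (hw.mul hf) M.measurable_state]
  rfl

/-- Boxes form a π-system generating the product σ-algebra, and the integrals are the values of two
measures on it, finite by `hfin`. -/
theorem setLIntegral_obs_ext (M : Model P 𝒳 T) {n : ℕ} {f g : Ω → ENNReal}
    (hfin : ∫⁻ ω, f ω ∂P ≠ ⊤)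
    (h : ∀ B : Fin n → Set 𝒳, (∀ k, MeasurableSet (B k)) →
      ∫⁻ ω in M.box B, f ω ∂P = ∫⁻ ω in M.box B, g ω ∂P)
    {B : Set (Fin n → 𝒳)} (hB : MeasurableSet B) :
    ∫⁻ ω in M.obs n ⁻¹' B, f ω ∂P = ∫⁻ ω in M.obs n ⁻¹' B, g ω ∂P := by
  have hm := M.measurable_obs n
  have : IsFiniteMeasure (P.withDensity f) := isFiniteMeasure_withDensity hfin
  have key : (P.withDensity f).map (M.obs n) = (P.withDensity g).map (M.obs n) := by
    refine ext_of_generate_finite _ generateFrom_pi.symm isPiSystem_pi ?_ ?_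
    · rintro _ ⟨B, hB, rfl⟩
      have hB' : ∀ k, MeasurableSet (B k) := fun k => hB k trivial
      have := MeasurableSet.univ_pi hB'
      rw [Measure.map_apply hm this, Measure.map_apply hm this, withDensity_apply _ (hm this),
        withDensity_apply _ (hm this)]
      exact h B hB'
    · have := h (fun _ => Set.univ) (fun _ => MeasurableSet.univ)
      rw [Measure.map_apply hm .univ, Measure.map_apply hm .univ, withDensity_apply _ (hm .univ),
        withDensity_apply _ (hm .univ)]
      simpa [box] using this
  have := congrArg (fun μ => μ B) key
  simpa only [Measure.map_apply hm hB, withDensity_apply _ (hm hB)] using this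

theorem lintegral_Θ_sq_ne_top (M : Model P 𝒳 T) : ∫⁻ ω, ENNReal.ofReal (M.Θ ω ^ 2) ∂P ≠ ⊤ := by
  have h := M.memLp_Θ.integrable_sq
  rw [← ofReal_integral_eq_lintegral_ofReal h (ae_of_all _ fun _ => sq_nonneg _)]
  exact ENNReal.ofReal_ne_top

theorem measurableSet_Λ (M : Model P 𝒳 T) (i : Fin 2) : MeasurableSet (M.Λ i) :=
  (M.convex_Λ i).ordConnected.measurableSet

/-- Supplies the default estimate needed where the posterior mean is not feasible. -/
theorem Λ_nonempty (M : Model P 𝒳 T) (i : Fin 2) : (M.Λ i).Nonempty := by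
  have h : ∃ᵐ ω ∂P, ω ∈ M.H ⁻¹' {i} := by
    rw [frequently_ae_mem_iff]
    exact (M.prior_pos i).ne'
  obtain ⟨ω, h1, h2⟩ := (h.and_eventually M.Θ_mem).exists
  exact ⟨M.Θ ω, by rw [← show M.H ω = i from h1]; exact h2⟩

theorem memLp_condH (M : Model P 𝒳 T) (i : Fin 2) : MemLp M.Θ 2 (M.condH i) :=
  (M.memLp_Θ.restrict _).smul_measure (by simp [(M.prior_pos i).ne'])

/-! ### Joint laws of the past with the state and with the next observation -/

section Laws

variable [IsProbabilityMeasure P]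

instance (M : Model P 𝒳 T) (n : ℕ) : IsMarkovKernel (M.posterior n) := by
  unfold posterior; infer_instance

instance (M : Model P 𝒳 T) (n : ℕ) : IsMarkovKernel (M.predictive n) := by
  unfold predictive; infer_instance

/-- The observations carry information on `H` only through `Θ`. -/
theorem measure_obs_inter_state (M : Model P 𝒳 T) {n : ℕ} (hn : n ≤ M.N)
    {B : Set (Fin n → 𝒳)} (hB : MeasurableSet B) {A : Set (Fin 2 × ℝ)} (hA : MeasurableSet A) :
    P (M.obs n ⁻¹' B ∩ M.state ⁻¹' A) =
      ∫⁻ ω in M.obs n ⁻¹' B, condDistrib M.state M.Θ P (M.Θ ω) A ∂P := by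
  have hA' := M.measurable_state hA
  have hφ : Measurable fun θ => condDistrib M.state M.Θ P θ A := Kernel.measurable_coe _ hA
  have h := M.setLIntegral_obs_ext (n := n) (f := (M.state ⁻¹' A).indicator 1)
    (g := fun ω => condDistrib M.state M.Θ P (M.Θ ω) A)
    (by simp [lintegral_indicator_one hA']) ?_ hB
  · rw [← h, lintegral_indicator_one hA', Measure.restrict_apply hA', Set.inter_comm]
  intro B hB
  have hw := M.measurable_boxLik hB
  have hw1 : Measurable fun z : ℝ × Fin 2 × ℝ => M.boxLik B z.1 := hw.comp measurable_fst
  rw [lintegral_indicator_one hA', Measure.restrict_apply hA', M.measure_box_inter hn hB hA]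
  have h1 := M.setLIntegral_box hn hB (hφ.comp measurable_snd)
  have h2 : ∫⁻ ω in M.state ⁻¹' A, M.boxLik B (M.Θ ω) ∂P =
      ∫⁻ z in Set.univ ×ˢ A, M.boxLik B z.1 ∂(P.map fun ω => (M.Θ ω, M.state ω)) := by
    rw [setLIntegral_map (MeasurableSet.univ.prod hA) hw1
      (M.measurable_Θ.prodMk M.measurable_state)]
    congr 2
    ext ω; simp
  -- The box likelihood depends on `Θ` only, so disintegrating the law of the state along `Θ` leaves
  -- it outside the inner integral.
  rw [h2, ← compProd_map_condDistrib M.measurable_state.aemeasurable,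
    Measure.setLIntegral_compProd hw1 .univ hA, Measure.restrict_univ,
    lintegral_map ?_ M.measurable_Θ]
  · simpa [setLIntegral_const, Function.comp_def, state] using h1.symm
  · simp only [setLIntegral_const]
    exact hw.mul hφ

/-- Sufficiency in kernel form: the conditional expectation given the observations is the one given
the statistic, which the `Θ`-marginal of `posterior` represents. -/
theorem compProd_snd_posterior (M : Model P 𝒳 T) {n : ℕ} (hn : n ≤ M.N) :
    P.map (fun ω => (M.obs n ω, M.Θ ω)) =
      (P.map (M.obs n)) ⊗ₘ ((M.posterior n).snd.comap (M.statOf n) (M.measurable_statOf n)) := by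
  have hm := M.measurable_obs n
  have : IsProbabilityMeasure (P.map (fun ω => (M.obs n ω, M.Θ ω))) :=
    Measure.isProbabilityMeasure_map (hm.prodMk M.measurable_Θ).aemeasurable
  refine Measure.ext_prod fun {B A} hB hA => ?_
  have hA' := M.measurable_Θ hA
  rw [Measure.map_apply (hm.prodMk M.measurable_Θ) (hB.prod hA),
    Measure.compProd_apply_prod hB hA, setLIntegral_map hB (Kernel.measurable_coe _ hA) hm]
  have h1 : (fun ω => (M.posterior n (M.stat n ω)).real (Prod.snd ⁻¹' A)) =ᵐ[P]
      P[(M.Θ ⁻¹' A).indicator (fun _ => (1 : ℝ)) | MeasurableSpace.comap (M.obs n) inferInstance] :=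
    (condDistrib_ae_eq_condExp (M.measurable_stat n) M.measurable_state
      (measurable_snd hA)).trans (M.sufficient n hn A hA).symm
  have h2 := setIntegral_condExp hm.comap_le (μ := P)
    ((integrable_const (1 : ℝ)).indicator hA') (s := M.obs n ⁻¹' B) ⟨B, hB, rfl⟩
  rw [← setIntegral_congr_ae (g := fun ω => _) (hm hB) (h1.mono fun ω h _ => h),
    integral_indicator_const _ hA', measureReal_restrict_apply hA'] at h2
  have h3 : ∫⁻ ω in M.obs n ⁻¹' B,
      ((M.posterior n).snd.comap (M.statOf n) (M.measurable_statOf n)) (M.obs n ω) A ∂P =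
      ENNReal.ofReal (∫ ω in M.obs n ⁻¹' B,
        (M.posterior n (M.stat n ω)).real (Prod.snd ⁻¹' A) ∂P) := by
    rw [ofReal_integral_eq_lintegral_ofReal]
    · refine lintegral_congr fun ω => ?_
      rw [Kernel.comap_apply, Kernel.snd_apply' _ _ hA, statOf_obs, ofReal_measureReal]
    · refine Integrable.of_bound (C := 1) ?_ ?_
      · exact ((Kernel.measurable_coe _ (measurable_snd hA)).comp
          (M.measurable_stat n)).ennreal_toReal.aestronglyMeasurable
      · exact ae_of_all _ fun ω => by
          rw [Real.norm_of_nonneg measureReal_nonneg]; exact measureReal_le_one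
    · exact ae_of_all _ fun ω => measureReal_nonneg
  rw [h3, h2, smul_eq_mul, mul_one, ofReal_measureReal, Set.inter_comm]
  rfl

/-- The joint law of the first `n` observations and `(H, Θ)`. -/
theorem compProd_posterior (M : Model P 𝒳 T) {n : ℕ} (hn : n ≤ M.N) :
    P.map (fun ω => (M.obs n ω, M.state ω)) =
      (P.map (M.obs n)) ⊗ₘ ((M.posterior n).comap (M.statOf n) (M.measurable_statOf n)) := by
  have hm := M.measurable_obs n
  have : IsProbabilityMeasure (P.map (fun ω => (M.obs n ω, M.state ω))) :=
    Measure.isProbabilityMeasure_map (hm.prodMk M.measurable_state).aemeasurable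
  refine Measure.ext_prod fun {B A} hB hA => ?_
  have hφ : Measurable fun θ => condDistrib M.state M.Θ P θ A := Kernel.measurable_coe _ hA
  -- Candidate for the posterior probability of `A`: the law of the state given `Θ`, averaged over
  -- the posterior of `Θ`. By construction it is a function of the statistic.
  set ψ : T → ENNReal := fun t => ∫⁻ θ, condDistrib M.state M.Θ P θ A ∂(M.posterior n).snd t
    with hψ
  have hψm : Measurable ψ := hφ.lintegral_kernel
  have key : ∀ {B : Set (Fin n → 𝒳)}, MeasurableSet B →
      P (M.obs n ⁻¹' B ∩ M.state ⁻¹' A) = ∫⁻ ω in M.obs n ⁻¹' B, ψ (M.stat n ω) ∂P := by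
    intro B hB
    have hφ2 : Measurable fun z : (Fin n → 𝒳) × ℝ => condDistrib M.state M.Θ P z.2 A :=
      hφ.comp measurable_snd
    rw [M.measure_obs_inter_state hn hB hA]
    have h2 : ∫⁻ ω in M.obs n ⁻¹' B, condDistrib M.state M.Θ P (M.Θ ω) A ∂P =
        ∫⁻ z in B ×ˢ Set.univ, condDistrib M.state M.Θ P z.2 A
          ∂(P.map fun ω => (M.obs n ω, M.Θ ω)) := by
      rw [setLIntegral_map (hB.prod .univ) hφ2 (hm.prodMk M.measurable_Θ)]
      congr 2
      ext ω; simp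
    rw [h2, M.compProd_snd_posterior hn, Measure.setLIntegral_compProd hφ2 hB .univ, setLIntegral_map hB ?_ hm]
    · simp [hψ, Measure.restrict_univ, Kernel.comap_apply, statOf_obs]
    · simp only [Measure.restrict_univ]
      exact hψm.comp (M.measurable_statOf n)
  -- Testing `key` on events determined by the statistic shows that `ψ` is a version of the
  -- posterior probability.
  have hae : (fun t => M.posterior n t A) =ᵐ[P.map (M.stat n)] ψ := by
    refine ae_eq_of_forall_setLIntegral_eq_of_sigmaFinite (Kernel.measurable_coe _ hA) hψm
      fun S hS _ => ?_
    rw [setLIntegral_map hS hψm (M.measurable_stat n), ← Measure.compProd_apply_prod hS hA]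
    have h1 := key (M.measurable_statOf n hS)
    have h2 : M.obs n ⁻¹' (M.statOf n ⁻¹' S) = M.stat n ⁻¹' S := by
      ext ω; simp [statOf_obs]
    rw [h2] at h1
    rw [← h1]
    change ((P.map (M.stat n)) ⊗ₘ condDistrib M.state (M.stat n) P) _ = _
    rw [compProd_map_condDistrib M.measurable_state.aemeasurable,
      Measure.map_apply ((M.measurable_stat n).prodMk M.measurable_state) (hS.prod hA)]
    rfl
  rw [Measure.map_apply (hm.prodMk M.measurable_state) (hB.prod hA),
    Measure.compProd_apply_prod hB hA, setLIntegral_map hB (Kernel.measurable_coe _ hA) hm]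
  change P (M.obs n ⁻¹' B ∩ M.state ⁻¹' A) = _
  rw [key hB]
  refine lintegral_congr_ae (ae_restrict_of_ae ?_)
  filter_upwards [ae_of_ae_map (M.measurable_stat n).aemeasurable hae] with ω hω
  rw [Kernel.comap_apply, statOf_obs, ← hω]

theorem lintegral_posterior (M : Model P 𝒳 T) {n : ℕ} (hn : n ≤ M.N)
    {f : (Fin n → 𝒳) × (Fin 2 × ℝ) → ENNReal} (hf : Measurable f) :
    ∫⁻ ω, f (M.obs n ω, M.state ω) ∂P =
      ∫⁻ ω, ∫⁻ y, f (M.obs n ω, y) ∂(M.posterior n (M.stat n ω)) ∂P := by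
  have hm := M.measurable_obs n
  rw [← lintegral_map hf (hm.prodMk M.measurable_state), M.compProd_posterior hn,
    Measure.lintegral_compProd hf, lintegral_map hf.lintegral_kernel_prod_right' hm]
  simp [Kernel.comap_apply, statOf_obs]

theorem setLIntegral_posterior (M : Model P 𝒳 T) {n : ℕ} (hn : n ≤ M.N)
    {S : Set (Fin n → 𝒳)} (hS : MeasurableSet S)
    {f : (Fin n → 𝒳) × (Fin 2 × ℝ) → ENNReal} (hf : Measurable f) :
    ∫⁻ ω in M.obs n ⁻¹' S, f (M.obs n ω, M.state ω) ∂P =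
      ∫⁻ ω in M.obs n ⁻¹' S, ∫⁻ y, f (M.obs n ω, y) ∂(M.posterior n (M.stat n ω)) ∂P := by
  have h := M.lintegral_posterior hn (hf.indicator (hS.preimage measurable_fst))
  rw [← lintegral_indicator (M.measurable_obs n hS), ← lintegral_indicator (M.measurable_obs n hS)]
  refine Eq.trans (lintegral_congr fun ω => ?_) (h.trans (lintegral_congr fun ω => ?_))
  · classical
    simp only [Set.indicator_apply, Set.mem_preimage]
  · by_cases hω : M.obs n ω ∈ S <;> simp [hω]

/-- On boxes this is the factorization for `n + 1` observations, the last side being split off by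
`Fin.snoc`. -/
theorem measure_obs_inter_next (M : Model P 𝒳 T) {n : ℕ} (hn : n < M.N)
    {B : Set (Fin n → 𝒳)} (hB : MeasurableSet B) {A : Set 𝒳} (hA : MeasurableSet A) :
    P (M.obs n ⁻¹' B ∩ M.X n ⁻¹' A) = ∫⁻ ω in M.obs n ⁻¹' B, M.lik (M.Θ ω) A ∂P := by
  have hA' := M.measurable_X n hA
  have hφ : Measurable fun θ => M.lik θ A := Kernel.measurable_coe _ hA
  have h := M.setLIntegral_obs_ext (n := n) (f := (M.X n ⁻¹' A).indicator 1)
    (g := fun ω => M.lik (M.Θ ω) A) (by simp [lintegral_indicator_one hA']) ?_ hB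
  · rw [← h, lintegral_indicator_one hA', Measure.restrict_apply hA', Set.inter_comm]
  intro B hB
  have h2 := M.setLIntegral_box (f := fun y => M.lik y.2 A) hn.le hB (hφ.comp measurable_snd)
  dsimp only [state] at h2
  rw [lintegral_indicator_one hA', Measure.restrict_apply hA', h2]
  have hB' : ∀ k, MeasurableSet ((Fin.snoc B A : Fin (n + 1) → Set 𝒳) k) :=
    Fin.lastCases (by simpa using hA) (by simpa using hB)
  have h1 := M.measure_box_inter (n := n + 1) hn hB' MeasurableSet.univ
  simp only [Set.preimage_univ, Set.univ_inter, Measure.restrict_univ, boxLik,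
    Fin.prod_univ_castSucc, Fin.snoc_castSucc, Fin.snoc_last] at h1
  refine Eq.trans ?_ h1
  congr 1
  ext ω
  simp [box, obs, Fin.forall_fin_succ', and_comm]

/-- The joint law of the first `n` observations and the next one. -/
theorem compProd_predictive (M : Model P 𝒳 T) {n : ℕ} (hn : n < M.N) :
    P.map (fun ω => (M.obs n ω, M.X n ω)) =
      (P.map (M.obs n)) ⊗ₘ ((M.predictive n).comap (M.statOf n) (M.measurable_statOf n)) := by
  have hm := M.measurable_obs n
  have hX := M.measurable_X n
  have : IsProbabilityMeasure (P.map (fun ω => (M.obs n ω, M.X n ω))) :=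
    Measure.isProbabilityMeasure_map (hm.prodMk hX).aemeasurable
  refine Measure.ext_prod fun {B A} hB hA => ?_
  have hφ : Measurable fun θ => M.lik θ A := Kernel.measurable_coe _ hA
  rw [Measure.map_apply (hm.prodMk hX) (hB.prod hA),
    Measure.compProd_apply_prod hB hA, setLIntegral_map hB (Kernel.measurable_coe _ hA) hm]
  change P (M.obs n ⁻¹' B ∩ M.X n ⁻¹' A) = _
  rw [M.measure_obs_inter_next hn hB hA, ← lintegral_indicator (hm hB),
    ← lintegral_indicator (hm hB)]
  have h := M.lintegral_posterior hn.le
    (f := (B ×ˢ Set.univ).indicator fun z => M.lik z.2.2 A)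
    ((hφ.comp (measurable_snd.comp measurable_snd)).indicator (hB.prod .univ))
  have e1 : ∀ ω y, (B ×ˢ Set.univ).indicator (fun z : (Fin n → 𝒳) × Fin 2 × ℝ => M.lik z.2.2 A)
      (M.obs n ω, y) = (M.obs n ⁻¹' B).indicator (fun _ => M.lik y.2 A) ω := fun ω y => by
    classical
    simp [Set.indicator_apply]
  simp only [e1] at h
  refine h.trans (lintegral_congr fun ω => ?_)
  by_cases hω : ω ∈ M.obs n ⁻¹' B
  · simp only [Set.indicator_of_mem hω, Kernel.comap_apply, statOf_obs]
    rw [predictive, Kernel.comp_apply' _ _ _ hA, Kernel.lintegral_snd _ _ hφ]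
  · simp [Set.indicator_of_notMem hω]

theorem lintegral_predictive (M : Model P 𝒳 T) {n : ℕ} (hn : n < M.N)
    {f : (Fin n → 𝒳) × 𝒳 → ENNReal} (hf : Measurable f) :
    ∫⁻ ω, f (M.obs n ω, M.X n ω) ∂P =
      ∫⁻ ω, ∫⁻ x, f (M.obs n ω, x) ∂(M.predictive n (M.stat n ω)) ∂P := by
  have hm := M.measurable_obs n
  rw [← lintegral_map hf (hm.prodMk (M.measurable_X n)), M.compProd_predictive hn,
    Measure.lintegral_compProd hf, lintegral_map hf.lintegral_kernel_prod_right' hm]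
  simp [Kernel.comap_apply, statOf_obs]

theorem measurable_lintegral_predictive (M : Model P 𝒳 T) (n : ℕ) {f : T → ENNReal}
    (hf : Measurable f) : Measurable fun t => ∫⁻ x, f (M.ξ t x) ∂(M.predictive n t) :=
  Measurable.lintegral_kernel_prod_right' (f := fun z : T × 𝒳 => f (M.ξ z.1 z.2))
    (hf.comp M.measurable_ξ)

theorem setLIntegral_stat_succ (M : Model P 𝒳 T) {n : ℕ} (hn : n < M.N) {S : Set (Fin n → 𝒳)}
    (hS : MeasurableSet S) {f : T → ENNReal} (hf : Measurable f) :
    ∫⁻ ω in M.obs n ⁻¹' S, f (M.stat (n + 1) ω) ∂P =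
      ∫⁻ ω in M.obs n ⁻¹' S, ∫⁻ x, f (M.ξ (M.stat n ω) x) ∂(M.predictive n (M.stat n ω)) ∂P := by
  have hp : Measurable fun z : (Fin n → 𝒳) × 𝒳 => (M.statOf n z.1, z.2) :=
    ((M.measurable_statOf n).comp measurable_fst).prodMk measurable_snd
  have h := M.lintegral_predictive hn
    (((hf.comp M.measurable_ξ).comp hp).indicator (hS.preimage measurable_fst))
  rw [← lintegral_indicator (M.measurable_obs n hS), ← lintegral_indicator (M.measurable_obs n hS)]
  refine Eq.trans (lintegral_congr fun ω => ?_) (h.trans (lintegral_congr fun ω => ?_))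
  · classical
    simp only [Set.indicator_apply, Set.mem_preimage, Function.comp_def, Function.uncurry,
      statOf_obs, ← stat_succ]
  · by_cases hω : M.obs n ω ∈ S <;> simp [hω, Function.uncurry, statOf_obs]

theorem lintegral_stat_succ (M : Model P 𝒳 T) {n : ℕ} (hn : n < M.N) {f : T → ENNReal}
    (hf : Measurable f) :
    ∫⁻ ω, f (M.stat (n + 1) ω) ∂P =
      ∫⁻ ω, ∫⁻ x, f (M.ξ (M.stat n ω) x) ∂(M.predictive n (M.stat n ω)) ∂P := by
  simpa using M.setLIntegral_stat_succ hn MeasurableSet.univ hf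

/-- Carries an almost sure property of `t_{n+1}` to almost every predicted successor of `t_n`, the
form that integrals in `contCost` require. -/
theorem ae_predictive (M : Model P 𝒳 T) {n : ℕ} (hn : n < M.N) {s : Set T} (hs : MeasurableSet s)
    (h : ∀ᵐ ω ∂P, M.stat (n + 1) ω ∈ s) :
    ∀ᵐ ω ∂P, ∀ᵐ x ∂(M.predictive n (M.stat n ω)), M.ξ (M.stat n ω) x ∈ s := by
  have hm := M.measurable_obs n
  have hX := M.measurable_X n
  have hg : Measurable fun z : (Fin n → 𝒳) × 𝒳 => M.ξ (M.statOf n z.1) z.2 :=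
    M.measurable_ξ.comp (((M.measurable_statOf n).comp measurable_fst).prodMk measurable_snd)
  have h1 : ∀ᵐ z ∂(P.map fun ω => (M.obs n ω, M.X n ω)), M.ξ (M.statOf n z.1) z.2 ∈ s := by
    rw [ae_map_iff (hm.prodMk hX).aemeasurable (hg hs)]
    simpa only [statOf_obs, stat_succ] using h
  rw [M.compProd_predictive hn] at h1
  have h2 := ae_of_ae_map hm.aemeasurable (Measure.ae_ae_of_ae_compProd h1)
  simpa only [Kernel.comap_apply, statOf_obs] using h2

end Laws

end Model

/-! ### Elementary facts on squared errors, means and the loss -/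

/-- Bias-variance decomposition. -/
theorem lintegral_sub_sq {α : Type*} [MeasurableSpace α] {μ : Measure α} [IsProbabilityMeasure μ]
    {f : α → ℝ} (hf : MemLp f 2 μ) (e : ℝ) :
    ∫⁻ a, ENNReal.ofReal ((f a - e) ^ 2) ∂μ =
      ENNReal.ofReal (variance f μ + (e - ∫ a, f a ∂μ) ^ 2) := by
  have hi : Integrable f μ := hf.integrable (by norm_num)
  have h2 : Integrable (fun a => (f a - e) ^ 2) μ := (hf.sub (memLp_const e)).integrable_sq
  rw [← ofReal_integral_eq_lintegral_ofReal h2 (ae_of_all _ fun a => sq_nonneg _)]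
  congr 1
  have hs := hf.integrable_sq
  rw [variance_eq_sub hf]
  have h3 : ∫ a, (f a - e) ^ 2 ∂μ = ∫ a, (f a ^ 2 - 2 * e * f a) + e ^ 2 ∂μ :=
    integral_congr_ae (ae_of_all _ fun a => by ring)
  have h4 : Integrable (fun a => f a ^ 2 - 2 * e * f a) μ := hs.sub (hi.const_mul _)
  rw [h3, integral_add h4 (integrable_const _), integral_sub hs (hi.const_mul _),
    integral_const_mul]
  simp only [integral_const, probReal_univ, smul_eq_mul, Pi.pow_apply]
  ring

/-- The unnormalized version remains valid for a null set `s`, where conditioning is degenerate but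
both sides vanish. -/
theorem setLIntegral_sub_sq {α : Type*} [MeasurableSpace α] {μ : Measure α}
    [IsProbabilityMeasure μ] {s : Set α} {f : α → ℝ} (hf : MemLp f 2 μ) (e : ℝ) :
    ∫⁻ a in s, ENNReal.ofReal ((f a - e) ^ 2) ∂μ =
      ENNReal.ofReal (μ.real s * (variance f (cond μ s) + (e - ∫ a, f a ∂(cond μ s)) ^ 2)) := by
  by_cases h0 : μ s = 0
  · simp [Measure.restrict_eq_zero.2 h0, measureReal_def, h0]
  have := cond_isProbabilityMeasure h0
  have hc : MemLp f 2 (cond μ s) := (hf.restrict s).smul_measure (by simp [h0])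
  have hr : μ.restrict s = μ s • cond μ s := by
    rw [ProbabilityTheory.cond, smul_smul, ENNReal.mul_inv_cancel h0 (measure_ne_top _ _), one_smul]
  rw [hr, lintegral_smul_measure, lintegral_sub_sq hc, measureReal_def,
    ENNReal.ofReal_mul ENNReal.toReal_nonneg, ENNReal.ofReal_toReal (measure_ne_top _ _),
    smul_eq_mul]

/-- The mean of a random variable with values in an interval lies in that interval. -/
theorem integral_mem_of_ordConnected {α : Type*} [MeasurableSpace α] {μ : Measure α}
    [IsProbabilityMeasure μ] {s : Set ℝ} (hs : s.OrdConnected) {f : α → ℝ} (hf : Integrable f μ)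
    (h : ∀ᵐ a ∂μ, f a ∈ s) : ∫ a, f a ∂μ ∈ s := by
  -- Off the exceptional null set `f` takes a value at most its mean and a value at least its mean;
  -- the interval contains everything between them.
  obtain ⟨a, ha, ha'⟩ := exists_notMem_null_le_integral hf (ae_iff.1 h)
  obtain ⟨b, hb, hb'⟩ := exists_notMem_null_integral_le hf (ae_iff.1 h)
  exact hs.out (by simpa using ha) (by simpa using hb) ⟨ha', hb'⟩

theorem fin_two_ne_iff {i j : Fin 2} : i ≠ j ↔ i = 1 - j := by
  revert i j; decide

theorem jointLoss_nonneg {C : Fin 4 → ℝ} (hC : 0 ≤ C) (d : Fin 2) (e : Fin 2 → ℝ) (h : Fin 2)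
    (θ : ℝ) : 0 ≤ jointLoss C d e h θ := by
  unfold jointLoss
  split_ifs
  · exact mul_nonneg (hC _) (sq_nonneg _)
  · exact hC _

theorem ofReal_jointLoss {C : Fin 4 → ℝ} (hC : 0 ≤ C) (d : Fin 2) (e : Fin 2 → ℝ) (h : Fin 2)
    (θ : ℝ) : ENNReal.ofReal (jointLoss C d e h θ) =
      ENNReal.ofReal (C (mse d)) * (if h = d then ENNReal.ofReal ((θ - e d) ^ 2) else 0) +
      ENNReal.ofReal (C (det (1 - d))) * (if h = 1 - d then 1 else 0) := by
  unfold jointLoss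
  by_cases hd : h = d
  · subst hd
    have : h ≠ 1 - h := by revert h; decide
    simp [this, ENNReal.ofReal_mul (hC _)]
  · have hd' := fin_two_ne_iff.1 hd
    have : d ≠ h := fun h' => hd h'.symm
    rw [if_neg this, if_neg hd, if_pos hd', ← hd']
    simp

/-! ### Posterior moments and the cost functions -/

namespace Model

variable {Ω : Type*} [MeasurableSpace Ω] {P : Measure Ω}
  {𝒳 : Type*} [MeasurableSpace 𝒳] {T : Type*} [MeasurableSpace T] [IsProbabilityMeasure P]

theorem ae_condH_iff (M : Model P 𝒳 T) (i : Fin 2) {p : Ω → Prop} :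
    (∀ᵐ ω ∂(M.condH i), p ω) ↔ ∀ᵐ ω ∂P, M.H ω = i → p ω := by
  rw [condH, ProbabilityTheory.cond, Measure.ae_ennreal_smul_measure_iff (by simp),
    ae_restrict_iff' (M.measurable_H (measurableSet_singleton i))]
  rfl

/-- The posterior mean `E[Θ | t_n = t, H_i]`. -/
def postMean (M : Model P 𝒳 T) (n : ℕ) (i : Fin 2) (t : T) : ℝ :=
  ∫ y, y.2 ∂(ProbabilityTheory.cond (M.posterior n t) {y | y.1 = i})

theorem measurableSet_fst_eq (i : Fin 2) : MeasurableSet {y : Fin 2 × ℝ | y.1 = i} :=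
  measurable_fst (measurableSet_singleton i)

theorem measurable_postProb (M : Model P 𝒳 T) (n : ℕ) (i : Fin 2) : Measurable (M.postProb n i) :=
  (Kernel.measurable_coe _ (measurableSet_fst_eq i)).ennreal_toReal

/-- Conditioning is done separately for each `t`; rescaling an integral against a restricted kernel
makes the dependence on `t` measurable. -/
theorem measurable_postMean (M : Model P 𝒳 T) (n : ℕ) (i : Fin 2) :
    Measurable (M.postMean n i) := by
  have h : M.postMean n i = fun t => ((M.posterior n t) {y | y.1 = i})⁻¹.toReal *
      ∫ y, y.2 ∂((M.posterior n).restrict (measurableSet_fst_eq i) t) := by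
    funext t
    rw [postMean, ProbabilityTheory.cond, integral_smul_measure, Kernel.restrict_apply, smul_eq_mul]
  rw [h]
  refine (Kernel.measurable_coe _ (measurableSet_fst_eq i)).inv.ennreal_toReal.mul ?_
  exact (StronglyMeasurable.integral_kernel_prod_right'
    (f := fun z : T × (Fin 2 × ℝ) => z.2.2)
    (measurable_snd.comp measurable_snd).stronglyMeasurable).measurable

theorem measurable_postVar (M : Model P 𝒳 T) (n : ℕ) (i : Fin 2) :
    Measurable (M.postVar n i) := by
  have h : M.postVar n i = fun t => (((M.posterior n t) {y | y.1 = i})⁻¹ *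
      ∫⁻ y in {y | y.1 = i}, ENNReal.ofReal ((y.2 - M.postMean n i t) ^ 2)
        ∂(M.posterior n t)).toReal := by
    funext t
    rw [postVar, variance, evariance_eq_lintegral_ofReal]
    conv_lhs => rw [ProbabilityTheory.cond, lintegral_smul_measure]
    rfl
  rw [h]
  refine ((Kernel.measurable_coe _ (measurableSet_fst_eq i)).inv.mul ?_).ennreal_toReal
  refine Measurable.setLIntegral_kernel_prod_right ?_ (measurableSet_fst_eq i)
  have : Measurable fun z : T × Fin 2 × ℝ => M.postMean n i z.1 :=
    (M.measurable_postMean n i).comp measurable_fst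
  exact (((measurable_snd.comp measurable_snd).sub this).pow_const 2).ennreal_ofReal

theorem postProb_nonneg (M : Model P 𝒳 T) (n : ℕ) (i : Fin 2) (t : T) : 0 ≤ M.postProb n i t :=
  measureReal_nonneg

theorem postVar_nonneg (M : Model P 𝒳 T) (n : ℕ) (i : Fin 2) (t : T) : 0 ≤ M.postVar n i t :=
  variance_nonneg _ _

theorem measurable_decCost (M : Model P 𝒳 T) (C : Fin 4 → ℝ) (n : ℕ) (i : Fin 2) :
    Measurable (M.decCost C n i) :=
  ((M.measurable_postProb n _).const_mul _).add
    (((M.measurable_postProb n _).const_mul _).mul (M.measurable_postVar n _))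

theorem decCost_mono (M : Model P 𝒳 T) {C C' : Fin 4 → ℝ} (h : C ≤ C') (n : ℕ) (i : Fin 2)
    (t : T) : M.decCost C n i t ≤ M.decCost C' n i t := by
  unfold decCost
  have h1 := M.postProb_nonneg n (1 - i) t
  have h2 := M.postProb_nonneg n i t
  have h3 := M.postVar_nonneg n i t
  gcongr
  · exact h _
  · exact h _

theorem decCost_nonneg (M : Model P 𝒳 T) {C : Fin 4 → ℝ} (hC : 0 ≤ C) (n : ℕ) (i : Fin 2)
    (t : T) : 0 ≤ M.decCost C n i t := by
  refine le_trans (by simp [decCost]) (M.decCost_mono hC n i t)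

theorem measurable_stopCost (M : Model P 𝒳 T) (C : Fin 4 → ℝ) (n : ℕ) :
    Measurable (M.stopCost C n) :=
  (M.measurable_decCost C n 0).min (M.measurable_decCost C n 1)

theorem stopCost_nonneg (M : Model P 𝒳 T) {C : Fin 4 → ℝ} (hC : 0 ≤ C) (n : ℕ) (t : T) :
    0 ≤ M.stopCost C n t :=
  le_min (M.decCost_nonneg hC n 0 t) (M.decCost_nonneg hC n 1 t)

theorem stopCost_le (M : Model P 𝒳 T) (C : Fin 4 → ℝ) (n : ℕ) (i : Fin 2) (t : T) :
    M.stopCost C n t ≤ M.decCost C n i t := by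
  fin_cases i
  · exact min_le_left _ _
  · exact min_le_right _ _

theorem measurable_integral_predictive (M : Model P 𝒳 T) (n : ℕ) {f : T → ℝ} (hf : Measurable f) :
    Measurable fun t => ∫ x, f (M.ξ t x) ∂(M.predictive n t) :=
  (StronglyMeasurable.integral_kernel_prod_right' (f := fun z : T × 𝒳 => f (M.ξ z.1 z.2))
    (hf.comp M.measurable_ξ).stronglyMeasurable).measurable

theorem measurable_rhoAux (M : Model P 𝒳 T) (C : Fin 4 → ℝ) (m n : ℕ) :
    Measurable (M.rhoAux C m n) := by
  induction m generalizing n with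
  | zero => exact M.measurable_stopCost C n
  | succ m ih =>
    exact (M.measurable_stopCost C n).min
      ((M.measurable_integral_predictive n (ih (n + 1))).const_add 1)

theorem rhoAux_nonneg (M : Model P 𝒳 T) {C : Fin 4 → ℝ} (hC : 0 ≤ C) (m n : ℕ) (t : T) :
    0 ≤ M.rhoAux C m n t := by
  induction m generalizing n t with
  | zero => exact M.stopCost_nonneg hC n t
  | succ m ih =>
    exact le_min (M.stopCost_nonneg hC n t)
      (add_nonneg zero_le_one (integral_nonneg fun x => ih _ _))

theorem rhoAux_le (M : Model P 𝒳 T) (C : Fin 4 → ℝ) (m n : ℕ) (t : T) :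
    M.rhoAux C m n t ≤ M.stopCost C n t := by
  cases m with
  | zero => exact le_rfl
  | succ m => exact min_le_left _ _

theorem measurable_rho (M : Model P 𝒳 T) (C : Fin 4 → ℝ) (n : ℕ) : Measurable (M.rho C n) :=
  M.measurable_rhoAux C _ n

theorem rho_nonneg (M : Model P 𝒳 T) {C : Fin 4 → ℝ} (hC : 0 ≤ C) (n : ℕ) (t : T) :
    0 ≤ M.rho C n t := M.rhoAux_nonneg hC _ n t

theorem rho_le_stopCost (M : Model P 𝒳 T) (C : Fin 4 → ℝ) (n : ℕ) (t : T) :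
    M.rho C n t ≤ M.stopCost C n t := M.rhoAux_le C _ n t

theorem measurable_contCost (M : Model P 𝒳 T) (C : Fin 4 → ℝ) (n : ℕ) :
    Measurable (M.contCost C n) :=
  (M.measurable_integral_predictive n (M.measurable_rho C (n + 1))).const_add 1

/-- The posterior expected loss is the cost of the decision plus a quadratic penalty for deviating
from the posterior mean. -/
theorem lintegral_jointLoss (M : Model P 𝒳 T) {C : Fin 4 → ℝ} (hC : 0 ≤ C) {n : ℕ} {t : T}
    (ht : MemLp (fun y : Fin 2 × ℝ => y.2) 2 (M.posterior n t)) (d : Fin 2) (e : Fin 2 → ℝ) :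
    ∫⁻ y, ENNReal.ofReal (jointLoss C d e y.1 y.2) ∂(M.posterior n t) =
      ENNReal.ofReal (M.decCost C n d t) +
        ENNReal.ofReal (C (mse d) * M.postProb n d t * (e d - M.postMean n d t) ^ 2) := by
  have h1 : ∫⁻ y : Fin 2 × ℝ, (if y.1 = d then ENNReal.ofReal ((y.2 - e d) ^ 2) else 0)
      ∂(M.posterior n t) = ENNReal.ofReal (M.postProb n d t *
        (M.postVar n d t + (e d - M.postMean n d t) ^ 2)) := by
    rw [postProb, postVar, postMean, ← setLIntegral_sub_sq ht,
      ← lintegral_indicator (measurableSet_fst_eq d)]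
    refine lintegral_congr fun y => ?_
    classical
    simp [Set.indicator_apply]
  have h2 : ∫⁻ y : Fin 2 × ℝ, (if y.1 = 1 - d then 1 else 0) ∂(M.posterior n t) =
      ENNReal.ofReal (M.postProb n (1 - d) t) := by
    rw [postProb, ofReal_measureReal, ← lintegral_indicator_one (measurableSet_fst_eq (1 - d))]
    refine lintegral_congr fun y => ?_
    classical
    simp [Set.indicator_apply]
  have hm : Measurable fun y : Fin 2 × ℝ =>
      if y.1 = d then ENNReal.ofReal ((y.2 - e d) ^ 2) else 0 :=
    Measurable.ite (measurableSet_fst_eq d) (by fun_prop) measurable_const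
  have hm' : Measurable fun y : Fin 2 × ℝ => if y.1 = 1 - d then (1 : ENNReal) else 0 :=
    Measurable.ite (measurableSet_fst_eq (1 - d)) measurable_const measurable_const
  simp only [ofReal_jointLoss hC]
  have p1 := M.postProb_nonneg n d t
  have p2 := M.postProb_nonneg n (1 - d) t
  have p3 := M.postVar_nonneg n d t
  have c1 := hC (mse d)
  have c2 := hC (det (1 - d))
  simp only [Pi.zero_apply] at c1 c2
  rw [lintegral_add_left (hm.const_mul _), lintegral_const_mul _ hm, lintegral_const_mul _ hm', h1,
    h2, ← ENNReal.ofReal_mul c1, ← ENNReal.ofReal_mul c2,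
    ← ENNReal.ofReal_add (by positivity) (by positivity),
    ← ENNReal.ofReal_add (M.decCost_nonneg hC _ _ _) (by positivity), decCost]
  ring_nf

theorem ae_memLp_posterior (M : Model P 𝒳 T) {n : ℕ} (hn : n ≤ M.N) :
    ∀ᵐ ω ∂P, MemLp (fun y : Fin 2 × ℝ => y.2) 2 (M.posterior n (M.stat n ω)) := by
  have hf : Measurable fun z : (Fin n → 𝒳) × (Fin 2 × ℝ) => ENNReal.ofReal (z.2.2 ^ 2) := by
    fun_prop
  have hf' : Measurable fun y : Fin 2 × ℝ => ENNReal.ofReal (y.2 ^ 2) := by fun_prop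
  have h := M.lintegral_posterior hn hf
  have h' := M.lintegral_Θ_sq_ne_top
  change ∫⁻ ω, ENNReal.ofReal (M.Θ ω ^ 2) ∂P = _ at h
  rw [h] at h'
  filter_upwards [ae_lt_top (hf'.lintegral_kernel.comp (M.measurable_stat n)) h'] with ω hω
  rw [memLp_two_iff_integrable_sq measurable_snd.aestronglyMeasurable]
  refine ⟨by fun_prop, ?_⟩
  rw [hasFiniteIntegral_iff_ofReal (ae_of_all _ fun _ => sq_nonneg _)]
  exact hω

/-- The decision cost is at most the posterior loss with any estimate. The estimate `0` serves here,
feasible or not, and reduces the claim to the second moment of `Θ`. -/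
theorem lintegral_decCost_ne_top (M : Model P 𝒳 T) {C : Fin 4 → ℝ} (hC : 0 ≤ C) {n : ℕ}
    (hn : n ≤ M.N) (i : Fin 2) :
    ∫⁻ ω, ENNReal.ofReal (M.decCost C n i (M.stat n ω)) ∂P ≠ ⊤ := by
  have hJ : Measurable fun z : (Fin n → 𝒳) × (Fin 2 × ℝ) =>
      ENNReal.ofReal (jointLoss C i 0 z.2.1 z.2.2) := by
    refine Measurable.ennreal_ofReal ?_
    unfold jointLoss
    refine Measurable.ite (measurableSet_eq_fun measurable_const (by fun_prop)) ?_ ?_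
    · have : Measurable fun h : Fin 2 => C (mse h) := measurable_of_finite _
      exact (this.comp (by fun_prop)).mul (by simp; fun_prop)
    · have : Measurable fun h : Fin 2 => C (det h) := measurable_of_finite _
      exact this.comp (by fun_prop)
  have h := M.lintegral_posterior hn hJ
  have h1 : ∫⁻ ω, ENNReal.ofReal (M.decCost C n i (M.stat n ω)) ∂P ≤
      ∫⁻ ω, ENNReal.ofReal (jointLoss C i 0 (M.H ω) (M.Θ ω)) ∂P := by
    refine le_trans (lintegral_mono_ae ?_) h.symm.le
    filter_upwards [M.ae_memLp_posterior hn] with ω hω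
    rw [M.lintegral_jointLoss hC hω]
    exact le_self_add
  refine ne_top_of_le_ne_top ?_ (h1.trans (lintegral_mono (g := fun ω =>
    ENNReal.ofReal (C (mse i)) * ENNReal.ofReal (M.Θ ω ^ 2) + ENNReal.ofReal (C (det (1 - i))))
    fun ω => ?_))
  · have := M.lintegral_Θ_sq_ne_top
    have hm := (M.measurable_Θ.pow_const 2).ennreal_ofReal
    rw [lintegral_add_left (hm.const_mul _), lintegral_const_mul _ hm]
    simp [ENNReal.mul_eq_top, this]
  · simp only [ofReal_jointLoss hC]
    gcongr
    · split_ifs <;> simp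
    · split_ifs <;> simp

theorem ae_integrable_decCost (M : Model P 𝒳 T) {C : Fin 4 → ℝ} (hC : 0 ≤ C) {n : ℕ}
    (hn : n < M.N) (i : Fin 2) :
    ∀ᵐ ω ∂P, Integrable (fun x => M.decCost C (n + 1) i (M.ξ (M.stat n ω) x))
      (M.predictive n (M.stat n ω)) := by
  have hD := M.measurable_decCost C (n + 1) i
  have h := M.lintegral_decCost_ne_top hC (n := n + 1) hn i
  rw [M.lintegral_stat_succ hn hD.ennreal_ofReal] at h
  filter_upwards [ae_lt_top ((M.measurable_lintegral_predictive n hD.ennreal_ofReal).comp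
    (M.measurable_stat n)) h] with ω hω
  refine ⟨(hD.comp (M.measurable_ξ.comp measurable_prodMk_left)).aestronglyMeasurable, ?_⟩
  rw [hasFiniteIntegral_iff_ofReal (ae_of_all _ fun _ => M.decCost_nonneg hC _ _ _)]
  exact hω

/-- A Bochner integral is zero by convention for a non-integrable function, so the real-valued
recursion needs integrability; it follows from `ρ ≤ g ≤ D_0`. -/
theorem ae_ofReal_contCost (M : Model P 𝒳 T) {C : Fin 4 → ℝ} (hC : 0 ≤ C) {n : ℕ} (hn : n < M.N) :
    ∀ᵐ ω ∂P, ENNReal.ofReal (M.contCost C n (M.stat n ω)) =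
      1 + ∫⁻ x, ENNReal.ofReal (M.rho C (n + 1) (M.ξ (M.stat n ω) x))
        ∂(M.predictive n (M.stat n ω)) := by
  filter_upwards [M.ae_integrable_decCost hC hn 0] with ω hω
  rw [contCost, ENNReal.ofReal_add zero_le_one (integral_nonneg fun _ => M.rho_nonneg hC _ _),
    ENNReal.ofReal_one, ofReal_integral_eq_lintegral_ofReal _
      (ae_of_all _ fun _ => M.rho_nonneg hC _ _)]
  refine hω.mono' ((M.measurable_rho C (n + 1)).comp
    (M.measurable_ξ.comp measurable_prodMk_left)).aestronglyMeasurable (ae_of_all _ fun x => ?_)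
  rw [Real.norm_of_nonneg (M.rho_nonneg hC _ _)]
  exact (M.rho_le_stopCost C _ _).trans (M.stopCost_le C _ 0 _)

/-- The true hypothesis almost never has zero posterior probability: disintegration gives such an
event mass zero. Hence under `H_i` the conditional posterior is a genuine probability measure. -/
theorem ae_postProb_ne_zero (M : Model P 𝒳 T) {n : ℕ} (hn : n ≤ M.N) (i : Fin 2) :
    ∀ᵐ ω ∂P, M.H ω = i → M.postProb n i (M.stat n ω) ≠ 0 := by
  have hZ : MeasurableSet {t | M.postProb n i t = 0} :=
    M.measurable_postProb n i (measurableSet_singleton 0)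
  have hS : MeasurableSet ((M.statOf n ⁻¹' {t | M.postProb n i t = 0}) ×ˢ
      {y : Fin 2 × ℝ | y.1 = i}) := (M.measurable_statOf n hZ).prod (measurableSet_fst_eq i)
  have h := M.lintegral_posterior hn (f := Set.indicator _ 1) (measurable_one.indicator hS)
  have hm : Measurable fun ω => Set.indicator ((M.statOf n ⁻¹' {t | M.postProb n i t = 0}) ×ˢ
      {y : Fin 2 × ℝ | y.1 = i}) (1 : (Fin n → 𝒳) × (Fin 2 × ℝ) → ENNReal)
      (M.obs n ω, M.state ω) :=
    (measurable_one.indicator hS).comp ((M.measurable_obs n).prodMk M.measurable_state)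
  have h0 : ∀ ω, ∫⁻ y, Set.indicator ((M.statOf n ⁻¹' {t | M.postProb n i t = 0}) ×ˢ
      {y : Fin 2 × ℝ | y.1 = i}) 1 (M.obs n ω, y) ∂(M.posterior n (M.stat n ω)) = (0 : ENNReal) := by
    intro ω
    by_cases hω : M.postProb n i (M.stat n ω) = 0
    · have : M.posterior n (M.stat n ω) {y | y.1 = i} = 0 := by
        rwa [postProb, measureReal_eq_zero_iff] at hω
      rw [← this, ← lintegral_indicator_one (measurableSet_fst_eq i)]
      refine lintegral_congr fun y => ?_
      classical
      simp [Set.indicator_apply, statOf_obs, hω]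
    · simp [statOf_obs, hω]
  simp only [h0, lintegral_zero] at h
  rw [lintegral_eq_zero_iff hm] at h
  filter_upwards [h] with ω hω hi h0
  simp [statOf_obs, h0, state, hi] at hω

/-- The posterior means take values in the parameter spaces. -/
theorem ae_postMean_mem (M : Model P 𝒳 T) {n : ℕ} (hn : n ≤ M.N) (i : Fin 2) :
    ∀ᵐ ω ∂P, M.postProb n i (M.stat n ω) ≠ 0 → M.postMean n i (M.stat n ω) ∈ M.Λ i := by
  have hS : MeasurableSet {y : Fin 2 × ℝ | y.1 = i ∧ y.2 ∉ M.Λ i} :=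
    (measurableSet_fst_eq i).inter (measurable_snd (M.measurableSet_Λ i)).compl
  have h := M.lintegral_posterior hn (f := fun z => Set.indicator _ 1 z.2)
    ((measurable_one.indicator hS).comp measurable_snd)
  simp only [lintegral_indicator_one hS] at h
  -- The event that `H = i` and `Θ ∉ Λ i` is null, so its posterior probability vanishes almost
  -- surely.
  have h0 : ∫⁻ ω, Set.indicator {y : Fin 2 × ℝ | y.1 = i ∧ y.2 ∉ M.Λ i} 1 (M.state ω) ∂P =
      (0 : ENNReal) := by
    refine lintegral_eq_zero_of_ae_eq_zero ?_
    filter_upwards [M.Θ_mem] with ω hω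
    refine Set.indicator_of_notMem ?_ _
    rintro ⟨h1, h2⟩
    exact h2 (by rw [← h1]; exact hω)
  have hm : Measurable fun ω => M.posterior n (M.stat n ω) {y | y.1 = i ∧ y.2 ∉ M.Λ i} :=
    (Kernel.measurable_coe _ hS).comp (M.measurable_stat n)
  rw [h0, eq_comm, lintegral_eq_zero_iff hm] at h
  filter_upwards [h, M.ae_memLp_posterior hn] with ω h1 h2 h3
  have h3' : M.posterior n (M.stat n ω) {y | y.1 = i} ≠ 0 := fun h => h3 (by
    rw [postProb, measureReal_def, h]; rfl)
  have := cond_isProbabilityMeasure h3'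
  refine integral_mem_of_ordConnected (M.convex_Λ i).ordConnected
    ((h2.integrable (by norm_num)).integrableOn.smul_measure (by simp [h3'])) ?_
  rw [ProbabilityTheory.cond, Measure.ae_ennreal_smul_measure_iff (by simp),
    ae_restrict_iff' (measurableSet_fst_eq i), ae_iff]
  have h4 : {y : Fin 2 × ℝ | ¬(y ∈ {y : Fin 2 × ℝ | y.1 = i} → y.2 ∈ M.Λ i)} =
      {y | y.1 = i ∧ y.2 ∉ M.Λ i} := by
    ext y; simp
  rw [h4]
  exact h1

end Model

theorem measurable_apply_of_countable {α β ι : Type*} [MeasurableSpace α] [MeasurableSpace β]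
    [MeasurableSpace ι] [Countable ι] [MeasurableSingletonClass ι] {f : ι → α → β}
    (hf : ∀ i, Measurable (f i)) {d : α → ι} (hd : Measurable d) :
    Measurable fun a => f (d a) a := by
  have : Measurable fun z : ι × α => f z.1 z.2 := measurable_from_prod_countable_right hf
  exact this.comp (hd.prodMk measurable_id)

/-! ### The run-length as a stopping time -/

namespace Model

variable {Ω : Type*} [MeasurableSpace Ω] {P : Measure Ω}
  {𝒳 : Type*} [MeasurableSpace 𝒳] {T : Type*} [MeasurableSpace T]

theorem runLength_le {M : Model P 𝒳 T} {π : Policy 𝒳} (hπ : M.Feasible π) (ω : Ω) :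
    M.runLength π ω ≤ M.N := Nat.sInf_le (hπ.halt_last _)

theorem halt_runLength {M : Model P 𝒳 T} {π : Policy 𝒳} (hπ : M.Feasible π) (ω : Ω) :
    π.halt (M.runLength π ω) (M.obs _ ω) = true :=
  Nat.sInf_mem (s := {n | π.halt n (M.obs n ω) = true}) ⟨M.N, hπ.halt_last _⟩

theorem le_runLength_iff {M : Model P 𝒳 T} {π : Policy 𝒳} (hπ : M.Feasible π) (n : ℕ) (ω : Ω) :
    n ≤ M.runLength π ω ↔ ∀ k < n, π.halt k (M.obs k ω) = false := by
  refine ⟨fun h k hk => ?_, fun h => ?_⟩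
  · rw [← Bool.not_eq_true]
    exact Nat.notMem_of_lt_sInf (hk.trans_le h)
  · by_contra! hlt
    have := h _ hlt
    rw [halt_runLength hπ] at this
    exact absurd this (by simp)

theorem runLength_eq_iff {M : Model P 𝒳 T} {π : Policy 𝒳} (hπ : M.Feasible π) (n : ℕ) (ω : Ω) :
    M.runLength π ω = n ↔ n ≤ M.runLength π ω ∧ π.halt n (M.obs n ω) = true := by
  refine ⟨fun h => ⟨h.ge, by subst h; exact halt_runLength hπ ω⟩, fun h => ?_⟩
  exact le_antisymm (Nat.sInf_le h.2) h.1

theorem lt_runLength_iff {M : Model P 𝒳 T} {π : Policy 𝒳} (hπ : M.Feasible π) (n : ℕ) (ω : Ω) :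
    n < M.runLength π ω ↔ n ≤ M.runLength π ω ∧ π.halt n (M.obs n ω) = false := by
  rw [lt_iff_le_and_ne, ← Bool.not_eq_true]
  refine and_congr_right fun h => ?_
  rw [ne_comm, Ne, runLength_eq_iff hπ]
  tauto

/-- The observations `x` for which `π` does not stop before time `n`. -/
def aliveSet (π : Policy 𝒳) (n : ℕ) : Set (Fin n → 𝒳) :=
  {x | ∀ k : Fin n, π.halt k (fun j : Fin k => x ⟨j, j.2.trans k.2⟩) = false}

theorem obs_preimage_aliveSet {M : Model P 𝒳 T} {π : Policy 𝒳} (hπ : M.Feasible π) (n : ℕ) :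
    M.obs n ⁻¹' aliveSet π n = {ω | n ≤ M.runLength π ω} := by
  ext ω
  simp only [Set.mem_preimage, aliveSet, Set.mem_ofPred_eq, le_runLength_iff hπ]
  exact ⟨fun h k hk => h ⟨k, hk⟩, fun h k => h k k.2⟩

theorem measurableSet_aliveSet {M : Model P 𝒳 T} {π : Policy 𝒳} (hπ : M.Feasible π) {n : ℕ}
    (hn : n ≤ M.N) : MeasurableSet (aliveSet π n) := by
  have : aliveSet π n = ⋂ k : Fin n,
      (fun (x : Fin n → 𝒳) (j : Fin k) => x ⟨j, j.2.trans k.2⟩) ⁻¹' (π.halt k ⁻¹' {false}) := by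
    ext x; simp [aliveSet]
  rw [this]
  exact MeasurableSet.iInter fun k => (measurable_pi_lambda _ fun j => measurable_pi_apply _)
    (hπ.measurable_halt k (k.2.le.trans hn) (measurableSet_singleton false))

/-- Stopping at `n` is decided by the first `n` observations, which permits conditioning on them
within this event. -/
theorem exists_runLength_eq {M : Model P 𝒳 T} {π : Policy 𝒳} (hπ : M.Feasible π) {n : ℕ}
    (hn : n ≤ M.N) : ∃ S, MeasurableSet S ∧ M.obs n ⁻¹' S = {ω | M.runLength π ω = n} := by
  refine ⟨aliveSet π n ∩ π.halt n ⁻¹' {true}, (measurableSet_aliveSet hπ hn).inter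
    (hπ.measurable_halt n hn (measurableSet_singleton true)), ?_⟩
  rw [Set.preimage_inter, obs_preimage_aliveSet hπ]
  ext ω
  simp [runLength_eq_iff hπ n]

theorem exists_lt_runLength {M : Model P 𝒳 T} {π : Policy 𝒳} (hπ : M.Feasible π) {n : ℕ}
    (hn : n ≤ M.N) : ∃ S, MeasurableSet S ∧ M.obs n ⁻¹' S = {ω | n < M.runLength π ω} := by
  refine ⟨aliveSet π n ∩ π.halt n ⁻¹' {false}, (measurableSet_aliveSet hπ hn).inter
    (hπ.measurable_halt n hn (measurableSet_singleton false)), ?_⟩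
  rw [Set.preimage_inter, obs_preimage_aliveSet hπ]
  ext ω
  simp [lt_runLength_iff hπ n]

theorem measurableSet_runLength_eq {M : Model P 𝒳 T} {π : Policy 𝒳} (hπ : M.Feasible π) (n : ℕ) :
    MeasurableSet {ω | M.runLength π ω = n} := by
  by_cases hn : n ≤ M.N
  · obtain ⟨S, hS, h⟩ := exists_runLength_eq hπ hn
    rw [← h]
    exact M.measurable_obs n hS
  · convert MeasurableSet.empty
    refine Set.eq_empty_of_forall_notMem fun ω hω => hn ?_
    rw [← show _ = n from hω]
    exact runLength_le hπ ω

theorem measurable_runLength {M : Model P 𝒳 T} {π : Policy 𝒳} (hπ : M.Feasible π) :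
    Measurable (M.runLength π) :=
  measurable_to_countable' (measurableSet_runLength_eq hπ)

theorem finalDec_of_runLength_eq {M : Model P 𝒳 T} {π : Policy 𝒳} {n : ℕ} {ω : Ω}
    (h : M.runLength π ω = n) : M.finalDec π ω = π.dec n (M.obs n ω) := by
  subst h; rfl

theorem finalEst_of_runLength_eq {M : Model P 𝒳 T} {π : Policy 𝒳} {n : ℕ} {ω : Ω}
    (h : M.runLength π ω = n) (i : Fin 2) : M.finalEst π i ω = π.est i n (M.obs n ω) := by
  subst h; rfl

/-- Policies are measurable only up to the horizon; truncating the time index at `N` changes nothing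
along the run. -/
theorem measurable_of_runLength {M : Model P 𝒳 T} {π : Policy 𝒳} (hπ : M.Feasible π)
    {β : Type*} [MeasurableSpace β] {f : Ω → β} {g : ℕ → Ω → β}
    (hg : ∀ n ≤ M.N, Measurable (g n)) (h : ∀ ω, f ω = g (M.runLength π ω) ω) : Measurable f := by
  have h1 : f = fun ω => (fun n ω => g (min n M.N) ω) (M.runLength π ω) ω := by
    funext ω
    simp only [h, min_eq_left (runLength_le hπ ω)]
  rw [h1]
  exact measurable_apply_of_countable (f := fun n ω => g (min n M.N) ω)
    (fun n => hg _ (min_le_right _ _)) (measurable_runLength hπ)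

theorem measurable_finalDec {M : Model P 𝒳 T} {π : Policy 𝒳} (hπ : M.Feasible π) :
    Measurable (M.finalDec π) :=
  measurable_of_runLength hπ (g := fun n ω => π.dec n (M.obs n ω))
    (fun n hn => (hπ.measurable_dec n hn).comp (M.measurable_obs n)) fun _ => rfl

theorem measurable_finalEst {M : Model P 𝒳 T} {π : Policy 𝒳} (hπ : M.Feasible π) (i : Fin 2) :
    Measurable (M.finalEst π i) :=
  measurable_of_runLength hπ (g := fun n ω => π.est i n (M.obs n ω))
    (fun n hn => (hπ.measurable_est i n hn).comp (M.measurable_obs n)) fun _ => rfl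

theorem measurable_jointLoss {α : Type*} [MeasurableSpace α] (C : Fin 4 → ℝ) {d h : α → Fin 2}
    {e : Fin 2 → α → ℝ} {θ : α → ℝ} (hd : Measurable d) (hh : Measurable h)
    (he : ∀ i, Measurable (e i)) (hθ : Measurable θ) :
    Measurable fun a => jointLoss C (d a) (fun i => e i a) (h a) (θ a) := by
  unfold jointLoss
  refine Measurable.ite (measurableSet_eq_fun hd hh) ?_ ?_
  · have h1 : Measurable fun h : Fin 2 => C (mse h) := measurable_of_finite _
    exact (h1.comp hh).mul ((hθ.sub (measurable_apply_of_countable he hh)).pow_const 2)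
  · have h1 : Measurable fun h : Fin 2 => C (det h) := measurable_of_finite _
    exact h1.comp hh

theorem measurable_finalLoss {M : Model P 𝒳 T} {π : Policy 𝒳} (hπ : M.Feasible π)
    (C : Fin 4 → ℝ) : Measurable fun ω =>
      jointLoss C (M.finalDec π ω) (fun i => M.finalEst π i ω) (M.H ω) (M.Θ ω) :=
  measurable_jointLoss C (measurable_finalDec hπ) M.measurable_H (measurable_finalEst hπ)
    M.measurable_Θ

/-! ### Exact decomposition of the objective into excess costs -/

section Excess

variable [IsProbabilityMeasure P]

/-- The penalty for an estimate `e` that is not the posterior mean. -/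
def estPenalty (M : Model P 𝒳 T) (C : Fin 4 → ℝ) (n : ℕ) (d : Fin 2) (e : ℝ) (t : T) : ℝ :=
  C (mse d) * M.postProb n d t * (e - M.postMean n d t) ^ 2

theorem estPenalty_nonneg (M : Model P 𝒳 T) {C : Fin 4 → ℝ} (hC : 0 ≤ C) (n : ℕ) (d : Fin 2)
    (e : ℝ) (t : T) : 0 ≤ M.estPenalty C n d e t :=
  mul_nonneg (mul_nonneg (hC _) (M.postProb_nonneg _ _ _)) (sq_nonneg _)

/-- The cost in excess of `ρ_n` that `π` incurs if it stops at time `n`. -/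
def stopExcess (M : Model P 𝒳 T) (C : Fin 4 → ℝ) (π : Policy 𝒳) (n : ℕ) (ω : Ω) : ENNReal :=
  ENNReal.ofReal (M.stopCost C n (M.stat n ω) - M.rho C n (M.stat n ω)) +
    (ENNReal.ofReal (M.decCost C n (π.dec n (M.obs n ω)) (M.stat n ω) -
      M.stopCost C n (M.stat n ω)) +
    ENNReal.ofReal (M.estPenalty C n (π.dec n (M.obs n ω))
      (π.est (π.dec n (M.obs n ω)) n (M.obs n ω)) (M.stat n ω)))

/-- The cost in excess of `ρ_n` that a policy incurs if it continues at time `n`. -/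
def contExcess (M : Model P 𝒳 T) (C : Fin 4 → ℝ) (n : ℕ) (ω : Ω) : ENNReal :=
  ENNReal.ofReal (M.contCost C n (M.stat n ω) - M.rho C n (M.stat n ω))

/-- The expected excess cost of `π` at time `n`. -/
def excess (M : Model P 𝒳 T) (C : Fin 4 → ℝ) (π : Policy 𝒳) (n : ℕ) : ENNReal :=
  ∫⁻ ω in {ω | M.runLength π ω = n}, M.stopExcess C π n ω ∂P +
    ∫⁻ ω in {ω | n < M.runLength π ω}, M.contExcess C n ω ∂P

theorem measurable_ofReal_rho (M : Model P 𝒳 T) (C : Fin 4 → ℝ) (n : ℕ) :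
    Measurable fun ω => ENNReal.ofReal (M.rho C n (M.stat n ω)) :=
  ((M.measurable_rho C n).comp (M.measurable_stat n)).ennreal_ofReal

theorem measurable_contExcess (M : Model P 𝒳 T) (C : Fin 4 → ℝ) (n : ℕ) :
    Measurable (M.contExcess C n) :=
  (((M.measurable_contCost C n).sub (M.measurable_rho C n)).comp
    (M.measurable_stat n)).ennreal_ofReal

theorem measurable_stopExcess {M : Model P 𝒳 T} {π : Policy 𝒳} (hπ : M.Feasible π)
    (C : Fin 4 → ℝ) {n : ℕ} (hn : n ≤ M.N) : Measurable (M.stopExcess C π n) := by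
  have ho := M.measurable_obs n
  have hs := M.measurable_stat n
  have hd := (hπ.measurable_dec n hn).comp ho
  have h1 : Measurable fun ω => M.decCost C n (π.dec n (M.obs n ω)) (M.stat n ω) :=
    measurable_apply_of_countable (f := fun d ω => M.decCost C n d (M.stat n ω))
      (fun d => (M.measurable_decCost C n d).comp hs) hd
  have h2 : Measurable fun ω => M.estPenalty C n (π.dec n (M.obs n ω))
      (π.est (π.dec n (M.obs n ω)) n (M.obs n ω)) (M.stat n ω) := by
    refine measurable_apply_of_countable
      (f := fun d ω => M.estPenalty C n d (π.est d n (M.obs n ω)) (M.stat n ω)) (fun d => ?_) hd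
    exact (((M.measurable_postProb n d).comp hs).const_mul _).mul
      ((((hπ.measurable_est d n hn).comp ho).sub ((M.measurable_postMean n d).comp hs)).pow_const 2)
  have h3 := (M.measurable_stopCost C n).comp hs
  have h4 := (M.measurable_rho C n).comp hs
  exact (h3.sub h4).ennreal_ofReal.add ((h1.sub h3).ennreal_ofReal.add h2.ennreal_ofReal)

/-- Given the observations, the expected loss is `D` plus the estimation penalty, and `D` telescopes
along `ρ ≤ g ≤ D`. -/
theorem setLIntegral_loss {M : Model P 𝒳 T} {π : Policy 𝒳} (hπ : M.Feasible π) {C : Fin 4 → ℝ}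
    (hC : 0 ≤ C) {n : ℕ} (hn : n ≤ M.N) :
    ∫⁻ ω in {ω | M.runLength π ω = n}, ENNReal.ofReal
      (jointLoss C (M.finalDec π ω) (fun i => M.finalEst π i ω) (M.H ω) (M.Θ ω)) ∂P =
    ∫⁻ ω in {ω | M.runLength π ω = n}, ENNReal.ofReal (M.rho C n (M.stat n ω)) ∂P +
      ∫⁻ ω in {ω | M.runLength π ω = n}, M.stopExcess C π n ω ∂P := by
  obtain ⟨S, hS, h⟩ := exists_runLength_eq hπ hn
  have hτ := measurableSet_runLength_eq hπ n
  have hJ : Measurable fun z : (Fin n → 𝒳) × (Fin 2 × ℝ) => ENNReal.ofReal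
      (jointLoss C (π.dec n z.1) (fun i => π.est i n z.1) z.2.1 z.2.2) :=
    (measurable_jointLoss C ((hπ.measurable_dec n hn).comp measurable_fst) (by fun_prop)
      (fun i => (hπ.measurable_est i n hn).comp measurable_fst) (by fun_prop)).ennreal_ofReal
  have h1 := M.setLIntegral_posterior hn hS hJ
  rw [h] at h1
  rw [← lintegral_add_left (M.measurable_ofReal_rho C n)]
  refine Eq.trans (setLIntegral_congr_fun hτ fun ω hω => ?_) (h1.trans
    (setLIntegral_congr_fun_ae hτ ?_))
  · simp only [finalDec_of_runLength_eq hω, finalEst_of_runLength_eq hω]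
    rfl
  · filter_upwards [M.ae_memLp_posterior hn] with ω hω _
    have e1 := M.rho_nonneg hC n (M.stat n ω)
    have e2 := M.rho_le_stopCost C n (M.stat n ω)
    have e3 := M.stopCost_le C n (π.dec n (M.obs n ω)) (M.stat n ω)
    have key : ENNReal.ofReal (M.decCost C n (π.dec n (M.obs n ω)) (M.stat n ω)) =
        ENNReal.ofReal (M.rho C n (M.stat n ω)) +
        ENNReal.ofReal (M.stopCost C n (M.stat n ω) - M.rho C n (M.stat n ω)) +
        ENNReal.ofReal (M.decCost C n (π.dec n (M.obs n ω)) (M.stat n ω) -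
          M.stopCost C n (M.stat n ω)) := by
      rw [← ENNReal.ofReal_add e1 (by linarith),
        ← ENNReal.ofReal_add (by linarith) (by linarith)]
      congr 1
      ring
    rw [M.lintegral_jointLoss hC hω, stopExcess, key]
    simp only [estPenalty, add_assoc]

/-- The Bellman step: `1` plus the predictive average of `ρ_{n+1}` is `d_n`, which is `ρ_n` plus the
excess of continuing. -/
theorem setLIntegral_contCost {M : Model P 𝒳 T} {π : Policy 𝒳} (hπ : M.Feasible π)
    {C : Fin 4 → ℝ} (hC : 0 ≤ C) {n : ℕ} (hn : n < M.N) :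
    P {ω | n < M.runLength π ω} +
      ∫⁻ ω in {ω | n < M.runLength π ω}, ENNReal.ofReal (M.rho C (n + 1) (M.stat (n + 1) ω)) ∂P =
    ∫⁻ ω in {ω | n < M.runLength π ω}, ENNReal.ofReal (M.rho C n (M.stat n ω)) ∂P +
      ∫⁻ ω in {ω | n < M.runLength π ω}, M.contExcess C n ω ∂P := by
  obtain ⟨S, hS, h⟩ := exists_lt_runLength hπ hn.le
  have h1 := M.setLIntegral_stat_succ hn hS (M.measurable_rho C (n + 1)).ennreal_ofReal
  rw [h] at h1
  rw [h1, ← lintegral_add_left (M.measurable_ofReal_rho C n),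
    ← setLIntegral_one, ← lintegral_add_left measurable_const]
  refine lintegral_congr_ae (ae_restrict_of_ae ?_)
  filter_upwards [M.ae_ofReal_contCost hC hn] with ω hω
  have e2 := M.rho_of_lt C hn (M.stat n ω)
  have e3 := min_le_right (M.stopCost C n (M.stat n ω)) (M.contCost C n (M.stat n ω))
  rw [← hω, contExcess, ← ENNReal.ofReal_add (M.rho_nonneg hC _ _) (by linarith)]
  congr 1
  simp

/-- The expected cost of `π` from time `n` on, when it is still running then. -/
theorem tailCost_eq {M : Model P 𝒳 T} {π : Policy 𝒳} (hπ : M.Feasible π)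
    {C : Fin 4 → ℝ} (hC : 0 ≤ C) (m : ℕ) {n : ℕ} (hn : n + m = M.N) :
    ∫⁻ ω in {ω | n ≤ M.runLength π ω}, (((M.runLength π ω - n : ℕ) : ENNReal) + ENNReal.ofReal
      (jointLoss C (M.finalDec π ω) (fun i => M.finalEst π i ω) (M.H ω) (M.Θ ω))) ∂P =
    ∫⁻ ω in {ω | n ≤ M.runLength π ω}, ENNReal.ofReal (M.rho C n (M.stat n ω)) ∂P +
      ∑ k ∈ Finset.Ico n (M.N + 1), M.excess C π k := by
  have hτ := measurableSet_runLength_eq hπ n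
  have hτ' : MeasurableSet {ω | n < M.runLength π ω} := measurable_runLength hπ measurableSet_Ioi
  have hun : {ω | n ≤ M.runLength π ω} = {ω | M.runLength π ω = n} ∪
      {ω | n < M.runLength π ω} := by
    ext ω
    simp only [Set.mem_ofPred_eq, Set.mem_union]
    omega
  have hdis : Disjoint {ω | M.runLength π ω = n} {ω | n < M.runLength π ω} :=
    Set.disjoint_left.2 fun ω h1 h2 => by
      simp only [Set.mem_ofPred_eq] at h1 h2
      omega
  have hloss := (measurable_finalLoss hπ C).ennreal_ofReal
  rw [hun, lintegral_union hτ' hdis, lintegral_union hτ' hdis,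
    Finset.sum_eq_sum_Ico_succ_bot (by omega), excess]
  have h1 : ∫⁻ ω in {ω | M.runLength π ω = n}, (((M.runLength π ω - n : ℕ) : ENNReal) +
      ENNReal.ofReal (jointLoss C (M.finalDec π ω) (fun i => M.finalEst π i ω) (M.H ω) (M.Θ ω))) ∂P
      = _ := Eq.trans (setLIntegral_congr_fun hτ fun ω hω => by
        have : M.runLength π ω = n := hω
        simp [this]) (setLIntegral_loss hπ hC (by omega))
  rw [h1]
  cases m with
  | zero =>
    have h0 : {ω | n < M.runLength π ω} = ∅ := by
      refine Set.eq_empty_of_forall_notMem fun ω hω => ?_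
      have := runLength_le hπ ω
      simp only [Set.mem_ofPred_eq] at hω
      omega
    simp only [h0, Measure.restrict_empty, lintegral_zero_measure, add_zero]
    rw [show n + 1 = M.N + 1 by omega]
    simp
  | succ m =>
    -- Backward induction on the number `m` of observations still available.
    have ih := tailCost_eq hπ hC m (n := n + 1) (by omega)
    -- The next observation contributes one unit of run-length, whose expectation is the probability
    -- of continuing.
    have h2 : ∫⁻ ω in {ω | n < M.runLength π ω}, (((M.runLength π ω - n : ℕ) : ENNReal) +
        ENNReal.ofReal (jointLoss C (M.finalDec π ω) (fun i => M.finalEst π i ω) (M.H ω) (M.Θ ω)))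
          ∂P = P {ω | n < M.runLength π ω} + ∫⁻ ω in {ω | n + 1 ≤ M.runLength π ω},
        (((M.runLength π ω - (n + 1) : ℕ) : ENNReal) + ENNReal.ofReal
          (jointLoss C (M.finalDec π ω) (fun i => M.finalEst π i ω) (M.H ω) (M.Θ ω))) ∂P := by
      have hset : {ω | n + 1 ≤ M.runLength π ω} = {ω | n < M.runLength π ω} := rfl
      rw [← setLIntegral_one, hset, ← lintegral_add_left measurable_const]
      refine setLIntegral_congr_fun hτ' fun ω hω => ?_
      simp only [Set.mem_ofPred_eq] at hω
      rw [show M.runLength π ω - n = 1 + (M.runLength π ω - (n + 1)) by omega, Nat.cast_add,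
        Nat.cast_one, add_assoc]
    rw [h2, ih, ← add_assoc (P _)]
    have h3 := setLIntegral_contCost hπ hC (n := n) (by omega)
    simp only [Nat.succ_le_iff]
    rw [h3]
    ring

/-- The tail identity at time `0`, where every run is alive and the statistic is constant. Bellman
optimality and the description of all minimizers both follow from it. -/
theorem objective_eq {M : Model P 𝒳 T} {π : Policy 𝒳} (hπ : M.Feasible π)
    {C : Fin 4 → ℝ} (hC : 0 ≤ C) :
    M.objective C π = ENNReal.ofReal (M.rho C 0 M.t₀) +
      ∑ k ∈ Finset.range (M.N + 1), M.excess C π k := by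
  have h := tailCost_eq hπ hC M.N (n := 0) (by omega)
  simp only [zero_le, Set.ofPred_true, Measure.restrict_univ, Nat.sub_zero] at h
  rw [Finset.range_eq_Ico]
  convert h using 2
  · refine lintegral_congr fun ω => ?_
    rw [ENNReal.ofReal_add (Nat.cast_nonneg _) (jointLoss_nonneg hC _ _ _ _),
      ENNReal.ofReal_natCast]
  · change _ = ∫⁻ ω, ENNReal.ofReal (M.rho C 0 M.t₀) ∂P
    simp

theorem excess_eq_zero_iff {M : Model P 𝒳 T} {π : Policy 𝒳} (hπ : M.Feasible π)
    {C : Fin 4 → ℝ} (hC : 0 ≤ C) {n : ℕ} (hn : n ≤ M.N) :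
    M.excess C π n = 0 ↔
      (∀ᵐ ω ∂P, M.runLength π ω = n →
        M.stopCost C n (M.stat n ω) = M.rho C n (M.stat n ω) ∧
        M.decCost C n (M.finalDec π ω) (M.stat n ω) = M.stopCost C n (M.stat n ω) ∧
        M.estPenalty C n (M.finalDec π ω) (M.finalEst π (M.finalDec π ω) ω) (M.stat n ω) = 0) ∧
      (∀ᵐ ω ∂P, n < M.runLength π ω → M.contCost C n (M.stat n ω) ≤ M.rho C n (M.stat n ω)) := by
  have hτ' : MeasurableSet {ω | n < M.runLength π ω} := measurable_runLength hπ measurableSet_Ioi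
  rw [excess, add_eq_zero, lintegral_eq_zero_iff (measurable_stopExcess hπ C hn),
    lintegral_eq_zero_iff (M.measurable_contExcess C n), Filter.EventuallyEq, Filter.EventuallyEq,
    ae_restrict_iff' (measurableSet_runLength_eq hπ n), ae_restrict_iff' hτ']
  refine and_congr (Filter.eventually_congr (ae_of_all _ fun ω => ?_))
    (Filter.eventually_congr (ae_of_all _ fun ω => ?_))
  · refine forall_congr' fun h => ?_
    have h : M.runLength π ω = n := h
    have e2 := M.rho_le_stopCost C n (M.stat n ω)
    have e3 := M.stopCost_le C n (π.dec n (M.obs n ω)) (M.stat n ω)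
    have e4 := M.estPenalty_nonneg hC n (π.dec n (M.obs n ω))
      (π.est (π.dec n (M.obs n ω)) n (M.obs n ω)) (M.stat n ω)
    rw [finalDec_of_runLength_eq h, finalEst_of_runLength_eq h, stopExcess, Pi.zero_apply,
      add_eq_zero, add_eq_zero, ENNReal.ofReal_eq_zero, ENNReal.ofReal_eq_zero,
      ENNReal.ofReal_eq_zero]
    refine and_congr ?_ (and_congr ?_ ?_)
    · exact ⟨fun h => by linarith, fun h => by linarith⟩
    · exact ⟨fun h => by linarith, fun h => by linarith⟩
    · exact ⟨fun h => le_antisymm h e4, fun h => h.le⟩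
  · simp [contExcess]

end Excess

end Model

theorem setIntegral_eq_mul_cond {α : Type*} [MeasurableSpace α] {μ : Measure α}
    [IsFiniteMeasure μ] (s : Set α) (f : α → ℝ) :
    ∫ a in s, f a ∂μ = μ.real s * ∫ a, f a ∂(cond μ s) := by
  by_cases h0 : μ s = 0
  · simp [Measure.restrict_eq_zero.2 h0, measureReal_def, h0]
  rw [ProbabilityTheory.cond, integral_smul_measure, smul_eq_mul, ← mul_assoc, measureReal_def,
    ← ENNReal.toReal_mul, ENNReal.mul_inv_cancel h0 (measure_ne_top _ _), ENNReal.toReal_one,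
    one_mul]

/-! ### Posterior means as conditional expectations -/

namespace Model

variable {Ω : Type*} [MeasurableSpace Ω] {P : Measure Ω}
  {𝒳 : Type*} [MeasurableSpace 𝒳] {T : Type*} [MeasurableSpace T] [IsProbabilityMeasure P]

instance (M : Model P 𝒳 T) (i : Fin 2) : IsProbabilityMeasure (M.condH i) :=
  cond_isProbabilityMeasure (M.prior_pos i).ne'

theorem integrable_posterior_iff (M : Model P 𝒳 T) {n : ℕ} (hn : n ≤ M.N)
    {f : (Fin n → 𝒳) × (Fin 2 × ℝ) → ℝ} (hf : Measurable f) :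
    Integrable (fun ω => f (M.obs n ω, M.state ω)) P ↔
      (∀ᵐ ω ∂P, Integrable (fun y => f (M.obs n ω, y)) (M.posterior n (M.stat n ω))) ∧
      Integrable (fun ω => ∫ y, ‖f (M.obs n ω, y)‖ ∂(M.posterior n (M.stat n ω))) P := by
  have hm := M.measurable_obs n
  have hp := hm.prodMk M.measurable_state
  have hs := hf.stronglyMeasurable
  have hc : (fun ω => f (M.obs n ω, M.state ω)) = f ∘ fun ω => (M.obs n ω, M.state ω) := rfl
  have hI : StronglyMeasurable fun x => ∫ y, ‖f (x, y)‖
      ∂((M.posterior n).comap (M.statOf n) (M.measurable_statOf n) x) :=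
    hs.norm.integral_kernel_prod_right'
  rw [hc, ← integrable_map_measure hs.aestronglyMeasurable hp.aemeasurable,
    M.compProd_posterior hn, Measure.integrable_compProd_iff hs.aestronglyMeasurable,
    integrable_map_measure hI.aestronglyMeasurable hm.aemeasurable, ae_map_iff hm.aemeasurable
      (measurableSet_kernel_integrable (f := fun x y => f (x, y)) hs)]
  simp only [Function.comp_def, Kernel.comap_apply, statOf_obs]

theorem integral_posterior (M : Model P 𝒳 T) {n : ℕ} (hn : n ≤ M.N)
    {f : (Fin n → 𝒳) × (Fin 2 × ℝ) → ℝ} (hf : Measurable f)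
    (hi : Integrable (fun ω => f (M.obs n ω, M.state ω)) P) :
    ∫ ω, f (M.obs n ω, M.state ω) ∂P =
      ∫ ω, ∫ y, f (M.obs n ω, y) ∂(M.posterior n (M.stat n ω)) ∂P := by
  have hm := M.measurable_obs n
  have hp := hm.prodMk M.measurable_state
  have hs := hf.stronglyMeasurable
  have hI : StronglyMeasurable fun x => ∫ y, f (x, y)
      ∂((M.posterior n).comap (M.statOf n) (M.measurable_statOf n) x) :=
    hs.integral_kernel_prod_right'
  have hi' : Integrable f (P.map fun ω => (M.obs n ω, M.state ω)) :=
    (integrable_map_measure hs.aestronglyMeasurable hp.aemeasurable).2 hi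
  have h := integral_map hp.aemeasurable (hs.aestronglyMeasurable (μ := P.map _))
  rw [← h]
  rw [M.compProd_posterior hn] at hi' ⊢
  rw [Measure.integral_compProd hi', integral_map hm.aemeasurable hI.aestronglyMeasurable]
  simp only [Kernel.comap_apply, statOf_obs]

/-- On the events that generate the conditioning under `H_i`, both integrals reduce to that of
`postProb * postMean`. -/
theorem setIntegral_postMean (M : Model P 𝒳 T) {n : ℕ} (hn : n ≤ M.N) (i : Fin 2)
    {B : Set (Fin n → 𝒳)} (hB : MeasurableSet B) :
    IntegrableOn (fun ω => M.postMean n i (M.stat n ω)) (M.obs n ⁻¹' B ∩ M.H ⁻¹' {i}) P ∧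
    ∫ ω in M.obs n ⁻¹' B ∩ M.H ⁻¹' {i}, M.postMean n i (M.stat n ω) ∂P =
      ∫ ω in M.obs n ⁻¹' B ∩ M.H ⁻¹' {i}, M.Θ ω ∂P := by
  classical
  have hS : MeasurableSet (B ×ˢ {y : Fin 2 × ℝ | y.1 = i}) := hB.prod (measurableSet_fst_eq i)
  have hA : MeasurableSet (M.obs n ⁻¹' B ∩ M.H ⁻¹' {i}) :=
    (M.measurable_obs n hB).inter (M.measurable_H (measurableSet_singleton i))
  have hpm : Measurable fun z : (Fin n → 𝒳) × (Fin 2 × ℝ) => M.postMean n i (M.statOf n z.1) :=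
    ((M.measurable_postMean n i).comp (M.measurable_statOf n)).comp measurable_fst
  have hsnd : Measurable fun z : (Fin n → 𝒳) × (Fin 2 × ℝ) => z.2.2 := by fun_prop
  set F := (B ×ˢ {y : Fin 2 × ℝ | y.1 = i}).indicator
    fun z : (Fin n → 𝒳) × (Fin 2 × ℝ) => z.2.2 with hF
  set G := (B ×ˢ {y : Fin 2 × ℝ | y.1 = i}).indicator
    fun z : (Fin n → 𝒳) × (Fin 2 × ℝ) => M.postMean n i (M.statOf n z.1) with hG
  have hFm : Measurable F := hsnd.indicator hS
  have hGm : Measurable G := hpm.indicator hS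
  have hFω : (fun ω => F (M.obs n ω, M.state ω)) =
      (M.obs n ⁻¹' B ∩ M.H ⁻¹' {i}).indicator M.Θ := by
    funext ω
    simp [hF, Set.indicator_apply, state]
  have hGω : (fun ω => G (M.obs n ω, M.state ω)) =
      (M.obs n ⁻¹' B ∩ M.H ⁻¹' {i}).indicator fun ω => M.postMean n i (M.stat n ω) := by
    funext ω
    simp [hG, Set.indicator_apply, state, statOf_obs]
  have hFi : Integrable (fun ω => F (M.obs n ω, M.state ω)) P := by
    rw [hFω]
    exact (M.memLp_Θ.integrable (by norm_num)).indicator hA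
  have hF1 : ∀ ω, ∫ y, F (M.obs n ω, y) ∂(M.posterior n (M.stat n ω)) =
      if M.obs n ω ∈ B then M.postProb n i (M.stat n ω) * M.postMean n i (M.stat n ω) else 0 := by
    intro ω
    split_ifs with h
    · rw [postProb, postMean, ← setIntegral_eq_mul_cond,
        ← integral_indicator (measurableSet_fst_eq i)]
      simp [hF, Set.indicator_apply, h]
    · simp [hF, h]
  have hG1 : ∀ ω y, G (M.obs n ω, y) = {y : Fin 2 × ℝ | y.1 = i}.indicator
      (fun _ => if M.obs n ω ∈ B then M.postMean n i (M.stat n ω) else 0) y := by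
    intro ω y
    by_cases h : M.obs n ω ∈ B <;> simp [hG, Set.indicator_apply, h, statOf_obs]
  have hG2 : ∀ ω, ∫ y, G (M.obs n ω, y) ∂(M.posterior n (M.stat n ω)) =
      if M.obs n ω ∈ B then M.postProb n i (M.stat n ω) * M.postMean n i (M.stat n ω) else 0 := by
    intro ω
    simp only [hG1]
    rw [integral_indicator_const _ (measurableSet_fst_eq i), smul_eq_mul, postProb]
    split_ifs <;> simp
  -- This bounds the posterior norm of `G` by that of `F`, so integrability passes from `Θ` to its
  -- posterior mean.
  have hG3 : ∀ ω, ∫ y, ‖G (M.obs n ω, y)‖ ∂(M.posterior n (M.stat n ω)) =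
      ‖∫ y, F (M.obs n ω, y) ∂(M.posterior n (M.stat n ω))‖ := by
    intro ω
    simp only [hG1, hF1, norm_indicator_eq_indicator_norm]
    rw [integral_indicator_const _ (measurableSet_fst_eq i), smul_eq_mul]
    have := M.postProb_nonneg n i (M.stat n ω)
    split_ifs
    · rw [norm_mul, Real.norm_of_nonneg this, postProb]
    · simp
  have hGi : Integrable (fun ω => G (M.obs n ω, M.state ω)) P := by
    rw [M.integrable_posterior_iff hn hGm]
    refine ⟨ae_of_all _ fun ω => ?_, ?_⟩
    · simp only [hG1]
      exact (integrable_const _).indicator (measurableSet_fst_eq i)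
    · simp only [hG3]
      have h := ((M.integrable_posterior_iff hn hFm).1 hFi).2
      refine h.mono' ?_ (ae_of_all _ fun ω => ?_)
      · have h1 : StronglyMeasurable fun x => ∫ y, F (x, y)
            ∂((M.posterior n).comap (M.statOf n) (M.measurable_statOf n) x) :=
          hFm.stronglyMeasurable.integral_kernel_prod_right'
        have h2 := (h1.norm.measurable.comp (M.measurable_obs n)).aestronglyMeasurable (μ := P)
        simpa only [Function.comp_def, Kernel.comap_apply, statOf_obs] using h2
      · rw [norm_norm]
        exact norm_integral_le_integral_norm _
  constructor
  · rw [hGω, integrable_indicator_iff hA] at hGi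
    exact hGi
  · have e1 := M.integral_posterior hn hFm hFi
    have e2 := M.integral_posterior hn hGm hGi
    rw [hFω, integral_indicator hA] at e1
    rw [hGω, integral_indicator hA] at e2
    rw [e1, e2]
    simp only [hF1, hG2]

/-- The posterior mean computed from the statistic is the conditional expectation. -/
theorem postMean_ae_eq_condExp (M : Model P 𝒳 T) {n : ℕ} (hn : n ≤ M.N) (i : Fin 2) :
    (fun ω => M.postMean n i (M.stat n ω)) =ᵐ[M.condH i]
      condExp (MeasurableSpace.comap (M.obs n) inferInstance) (M.condH i) M.Θ := by
  have hi := M.measurable_H (measurableSet_singleton i)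
  have hr : ∀ s : Set Ω, MeasurableSet s → (M.condH i).restrict s =
      (P (M.H ⁻¹' {i}))⁻¹ • P.restrict (s ∩ M.H ⁻¹' {i}) := by
    intro s hs
    rw [condH, ProbabilityTheory.cond, Measure.restrict_smul, Measure.restrict_restrict hs]
  refine ae_eq_condExp_of_forall_setIntegral_eq (M.measurable_obs n).comap_le
    ((M.memLp_condH i).integrable (by norm_num)) ?_ ?_ ?_
  · rintro _ ⟨B, hB, rfl⟩ -
    rw [IntegrableOn, hr _ (M.measurable_obs n hB)]
    exact (M.setIntegral_postMean hn i hB).1.smul_measure (by simp [(M.prior_pos i).ne'])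
  · rintro _ ⟨B, hB, rfl⟩ -
    rw [hr _ (M.measurable_obs n hB), integral_smul_measure, integral_smul_measure,
      (M.setIntegral_postMean hn i hB).2]
  · refine (Measurable.stronglyMeasurable ?_).aestronglyMeasurable
    have h : (fun ω => M.postMean n i (M.stat n ω)) =
        (M.postMean n i ∘ M.statOf n) ∘ M.obs n := by
      funext ω; simp [statOf_obs]
    rw [h]
    exact ((M.measurable_postMean n i).comp (M.measurable_statOf n)).comp
      (comap_measurable _)

/-! ### The dynamic programming policy and the minimizers -/

open Classical in
/-- The posterior mean, replaced by a fixed parameter where it is not a feasible estimate. -/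
def postEst (M : Model P 𝒳 T) (n : ℕ) (i : Fin 2) (t : T) : ℝ :=
  if M.postMean n i t ∈ M.Λ i then M.postMean n i t else (M.Λ_nonempty i).some

theorem measurable_postEst (M : Model P 𝒳 T) (n : ℕ) (i : Fin 2) : Measurable (M.postEst n i) :=
  Measurable.ite (M.measurable_postMean n i (M.measurableSet_Λ i)) (M.measurable_postMean n i)
    measurable_const

theorem postEst_mem (M : Model P 𝒳 T) (n : ℕ) (i : Fin 2) (t : T) : M.postEst n i t ∈ M.Λ i := by
  unfold postEst
  split_ifs with h
  · exact h
  · exact (M.Λ_nonempty i).some_mem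

theorem ae_postEst_eq (M : Model P 𝒳 T) {n : ℕ} (hn : n ≤ M.N) (i : Fin 2) :
    ∀ᵐ ω ∂P, M.postProb n i (M.stat n ω) ≠ 0 →
      M.postEst n i (M.stat n ω) = M.postMean n i (M.stat n ω) := by
  filter_upwards [M.ae_postMean_mem hn i] with ω hω h
  exact if_pos (hω h)

open Classical in
/-- The dynamic programming policy for the weights `C`: stop as soon as stopping is not more
expensive than continuing. -/
def optPolicy (M : Model P 𝒳 T) (C : Fin 4 → ℝ) : Policy 𝒳 where
  -- The first alternative forces the stop at the horizon, where `contCost` has no meaning.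
  halt n x := decide (M.N ≤ n ∨ M.stopCost C n (M.statOf n x) ≤ M.contCost C n (M.statOf n x))
  dec n x := if M.decCost C n 0 (M.statOf n x) ≤ M.decCost C n 1 (M.statOf n x) then 0 else 1
  est i n x := M.postEst n i (M.statOf n x)

theorem optPolicy_halt_iff (M : Model P 𝒳 T) (C : Fin 4 → ℝ) (n : ℕ) (ω : Ω) :
    (M.optPolicy C).halt n (M.obs n ω) = true ↔
      M.N ≤ n ∨ M.stopCost C n (M.stat n ω) ≤ M.contCost C n (M.stat n ω) := by
  simp [optPolicy, statOf_obs]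

theorem feasible_optPolicy (M : Model P 𝒳 T) (C : Fin 4 → ℝ) : M.Feasible (M.optPolicy C) where
  measurable_halt n _ := by
    refine measurable_to_bool ?_
    have hs := M.measurable_statOf n
    have h : (M.optPolicy C).halt n ⁻¹' {true} = {_x : Fin n → 𝒳 | M.N ≤ n} ∪
        {x | M.stopCost C n (M.statOf n x) ≤ M.contCost C n (M.statOf n x)} := by
      ext x; simp [optPolicy]
    rw [h]
    exact (MeasurableSet.const _).union (measurableSet_le ((M.measurable_stopCost C n).comp hs)
      ((M.measurable_contCost C n).comp hs))
  measurable_dec n _ := by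
    have hs := M.measurable_statOf n
    exact Measurable.ite (measurableSet_le ((M.measurable_decCost C n 0).comp hs)
      ((M.measurable_decCost C n 1).comp hs)) measurable_const measurable_const
  measurable_est i n _ := (M.measurable_postEst n i).comp (M.measurable_statOf n)
  est_mem i n _ x := M.postEst_mem n i _
  halt_last x := by simp [optPolicy]

theorem optPolicy_usesPosteriorMeans (M : Model P 𝒳 T) (C : Fin 4 → ℝ) :
    M.UsesPosteriorMeans (M.optPolicy C) := by
  intro i n hn
  refine Filter.EventuallyEq.trans ?_ (M.postMean_ae_eq_condExp hn i)
  rw [Filter.EventuallyEq, ae_condH_iff]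
  filter_upwards [M.ae_postEst_eq hn i, M.ae_postProb_ne_zero hn i] with ω h1 h2 h3
  rw [← h1 (h2 h3), ← statOf_obs]
  rfl

theorem decCost_optPolicy (M : Model P 𝒳 T) (C : Fin 4 → ℝ) (n : ℕ) (ω : Ω) :
    M.decCost C n ((M.optPolicy C).dec n (M.obs n ω)) (M.stat n ω) = M.stopCost C n (M.stat n ω) := by
  simp only [optPolicy, statOf_obs, stopCost]
  split_ifs with h
  · rw [min_eq_left h]
  · rw [min_eq_right (not_le.1 h).le]

theorem excess_optPolicy (M : Model P 𝒳 T) {C : Fin 4 → ℝ} (hC : 0 ≤ C) {n : ℕ} (hn : n ≤ M.N) :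
    M.excess C (M.optPolicy C) n = 0 := by
  have hf := M.feasible_optPolicy C
  rw [excess_eq_zero_iff hf hC hn]
  constructor
  · filter_upwards [M.ae_postEst_eq hn 0, M.ae_postEst_eq hn 1] with ω h0 h1 hτ
    rw [finalDec_of_runLength_eq hτ, finalEst_of_runLength_eq hτ]
    refine ⟨?_, M.decCost_optPolicy C n ω, ?_⟩
    · have h := ((runLength_eq_iff hf n ω).1 hτ).2
      rw [optPolicy_halt_iff] at h
      rcases hn.eq_or_lt with rfl | hlt
      · rw [rho_last]
      · rw [M.rho_of_lt C hlt, min_eq_left (h.resolve_left (not_le.2 hlt))]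
    · have key : ∀ d : Fin 2, M.estPenalty C n d ((M.optPolicy C).est d n (M.obs n ω))
          (M.stat n ω) = 0 := by
        intro d
        have hd : M.postProb n d (M.stat n ω) ≠ 0 →
            M.postEst n d (M.stat n ω) = M.postMean n d (M.stat n ω) := by
          fin_cases d
          · exact h0
          · exact h1
        by_cases hp : M.postProb n d (M.stat n ω) = 0
        · simp [estPenalty, hp]
        · simp [estPenalty, optPolicy, statOf_obs, hd hp]
      exact key _
  · refine ae_of_all _ fun ω hτ => ?_
    have h := ((lt_runLength_iff hf n ω).1 hτ).2
    rw [← Bool.not_eq_true, optPolicy_halt_iff, not_or, not_le, not_le] at h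
    rw [M.rho_of_lt C h.1, min_eq_right h.2.le]

theorem objective_optPolicy (M : Model P 𝒳 T) {C : Fin 4 → ℝ} (hC : 0 ≤ C) :
    M.objective C (M.optPolicy C) = ENNReal.ofReal (M.rho C 0 M.t₀) := by
  rw [objective_eq (M.feasible_optPolicy C) hC, Finset.sum_eq_zero, add_zero]
  intro k hk
  exact M.excess_optPolicy hC (by simpa [Nat.lt_succ_iff] using hk)

theorem le_objective {M : Model P 𝒳 T} {π : Policy 𝒳} (hπ : M.Feasible π) {C : Fin 4 → ℝ}
    (hC : 0 ≤ C) : ENNReal.ofReal (M.rho C 0 M.t₀) ≤ M.objective C π := by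
  rw [objective_eq hπ hC]
  exact le_self_add

theorem minimizes_iff (M : Model P 𝒳 T) {C : Fin 4 → ℝ} (hC : 0 ≤ C) (π : Policy 𝒳) :
    M.Minimizes C π ↔ M.Feasible π ∧ M.objective C π ≤ ENNReal.ofReal (M.rho C 0 M.t₀) := by
  refine and_congr_right fun hπ => ⟨fun h => ?_, fun h π' hπ' => h.trans (le_objective hπ' hC)⟩
  rw [← M.objective_optPolicy hC]
  exact h _ (M.feasible_optPolicy C)

theorem isOptimalPolicy_optPolicy (M : Model P 𝒳 T) {C : Fin 4 → ℝ} (hC : 0 ≤ C) :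
    M.IsOptimalPolicy C (M.optPolicy C) :=
  ⟨(M.minimizes_iff hC _).2 ⟨M.feasible_optPolicy C, (M.objective_optPolicy hC).le⟩,
    M.optPolicy_usesPosteriorMeans C⟩

/-- The optimal value is finite and can be cancelled, leaving a vanishing sum of nonnegative
excesses. -/
theorem Minimizes.excess_eq_zero {M : Model P 𝒳 T} {C : Fin 4 → ℝ} (hC : 0 ≤ C) {π : Policy 𝒳}
    (h : M.Minimizes C π) {n : ℕ} (hn : n ≤ M.N) : M.excess C π n = 0 := by
  obtain ⟨hπ, hle⟩ := (M.minimizes_iff hC π).1 h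
  rw [objective_eq hπ hC] at hle
  have h0 := ENNReal.le_of_add_le_add_left ENNReal.ofReal_ne_top
    (hle.trans_eq (add_zero _).symm)
  exact Finset.sum_eq_zero_iff.1 (le_zero_iff.1 h0) n (by simpa [Nat.lt_succ_iff] using hn)

/-- Along `ω` the policy `π` strictly follows the dynamic programming rule for the weights `C`. -/
def FollowsOptimal (M : Model P 𝒳 T) (C : Fin 4 → ℝ) (π : Policy 𝒳) (ω : Ω) : Prop :=
  (∀ n < M.runLength π ω, M.contCost C n (M.stat n ω) < M.stopCost C n (M.stat n ω)) ∧
  (∀ n, M.runLength π ω = n →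
    (n < M.N → M.stopCost C n (M.stat n ω) < M.contCost C n (M.stat n ω)) ∧
    M.decCost C n (M.finalDec π ω) (M.stat n ω) = M.stopCost C n (M.stat n ω) ∧
    M.decCost C n 0 (M.stat n ω) ≠ M.decCost C n 1 (M.stat n ω))

/-- Zero excess gives the weak inequalities and the absence of ties makes them strict. Ties are
excluded only after strict continuation at all earlier times, hence the strong induction. -/
theorem Minimizes.ae_followsOptimal {M : Model P 𝒳 T} {C : Fin 4 → ℝ} (hC : 0 ≤ C)
    (hties : M.NoTies C) {π : Policy 𝒳} (h : M.Minimizes C π) :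
    ∀ᵐ ω ∂P, M.FollowsOptimal C π ω := by
  have hπ := h.1
  have h1 : ∀ᵐ ω ∂P, ∀ n, n ≤ M.N → M.runLength π ω = n →
        M.stopCost C n (M.stat n ω) = M.rho C n (M.stat n ω) ∧
        M.decCost C n (M.finalDec π ω) (M.stat n ω) = M.stopCost C n (M.stat n ω) :=
    ae_all_iff.2 fun n => by
      by_cases hn : n ≤ M.N
      · filter_upwards [((excess_eq_zero_iff hπ hC hn).1 (h.excess_eq_zero hC hn)).1] with ω hω _ hτ
        exact ⟨(hω hτ).1, (hω hτ).2.1⟩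
      · exact ae_of_all _ fun _ h => absurd h hn
  have h2 : ∀ᵐ ω ∂P, ∀ n, n < M.runLength π ω →
      M.contCost C n (M.stat n ω) ≤ M.rho C n (M.stat n ω) :=
    ae_all_iff.2 fun n => by
      by_cases hn : n ≤ M.N
      · exact ((excess_eq_zero_iff hπ hC hn).1 (h.excess_eq_zero hC hn)).2
      · exact ae_of_all _ fun ω h => absurd (h.le.trans (runLength_le hπ ω)) hn
  filter_upwards [h1, h2, hties] with ω e1 e2 e3
  have hτN := runLength_le hπ ω
  have hcont : ∀ n < M.runLength π ω,
      M.contCost C n (M.stat n ω) < M.stopCost C n (M.stat n ω) := by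
    intro n
    induction n using Nat.strong_induction_on with
    | _ n ih =>
      intro hn
      have hN : n < M.N := hn.trans_le hτN
      have h4 := (e3 n hN.le fun k hk => ih k hk (hk.trans hn)).1 hN
      have h5 := e2 n hn
      rw [M.rho_of_lt C hN] at h5
      exact lt_of_le_of_ne (h5.trans (min_le_left _ _)) h4.symm
  refine ⟨hcont, ?_⟩
  rintro n rfl
  have h4 := e3 _ hτN hcont
  have h5 := e1 _ hτN rfl
  have h6 : M.runLength π ω < M.N → M.stopCost C (M.runLength π ω) (M.stat _ ω) <
      M.contCost C (M.runLength π ω) (M.stat _ ω) := fun hN => by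
    have h7 := h5.1
    rw [M.rho_of_lt C hN] at h7
    exact lt_of_le_of_ne (h7.trans_le (min_le_right _ _)) (h4.1 hN)
  exact ⟨h6, h5.2, h4.2 (hτN.eq_or_lt.imp id h6)⟩

/-- If one run were shorter, the two policies would require opposite strict inequalities between
stopping and continuing at its end. -/
theorem FollowsOptimal.eq {M : Model P 𝒳 T} {C : Fin 4 → ℝ} {π π' : Policy 𝒳}
    (hπ : M.Feasible π) (hπ' : M.Feasible π') {ω : Ω} (h : M.FollowsOptimal C π ω)
    (h' : M.FollowsOptimal C π' ω) :
    M.runLength π ω = M.runLength π' ω ∧ M.finalDec π ω = M.finalDec π' ω := by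
  have hτ : M.runLength π ω = M.runLength π' ω := by
    rcases lt_trichotomy (M.runLength π ω) (M.runLength π' ω) with hlt | heq | hlt
    · exact absurd (h'.1 _ hlt) ((h.2 _ rfl).1 (hlt.trans_le (runLength_le hπ' ω))).not_gt
    · exact heq
    · exact absurd (h.1 _ hlt) ((h'.2 _ rfl).1 (hlt.trans_le (runLength_le hπ ω))).not_gt
  refine ⟨hτ, ?_⟩
  obtain ⟨-, h1, h2⟩ := h.2 _ hτ
  obtain ⟨-, h3, -⟩ := h'.2 _ rfl
  rw [← h3] at h1
  revert h1
  generalize M.finalDec π ω = d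
  generalize M.finalDec π' ω = d'
  fin_cases d <;> fin_cases d' <;> simp_all [eq_comm]

end Model

namespace Model

variable {Ω : Type*} [MeasurableSpace Ω] {P : Measure Ω}
  {𝒳 : Type*} [MeasurableSpace 𝒳] {T : Type*} [MeasurableSpace T]

open Filter Topology

/-! ### Losses of the final decision and estimate -/

theorem estErr_eq_lintegral {M : Model P 𝒳 T} {π : Policy 𝒳} (hπ : M.Feasible π) (i : Fin 2) :
    M.estErr π i = ∫⁻ ω, (if M.finalDec π ω = i then
      ENNReal.ofReal ((M.finalEst π i ω - M.Θ ω) ^ 2) else 0) ∂(M.condH i) := by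
  have h : MeasurableSet {ω | M.finalDec π ω = i} :=
    measurable_finalDec hπ (measurableSet_singleton _)
  rw [estErr, ← lintegral_indicator h]
  refine lintegral_congr fun ω => ?_
  classical
  simp [Set.indicator_apply]

theorem measurable_decErr {M : Model P 𝒳 T} {π : Policy 𝒳} (hπ : M.Feasible π) (i : Fin 2) :
    Measurable fun ω => if M.finalDec π ω = i then (1 : ENNReal) else 0 :=
  Measurable.ite (measurable_finalDec hπ (measurableSet_singleton _)) measurable_const
    measurable_const

theorem measurable_sqErr {M : Model P 𝒳 T} {π : Policy 𝒳} (hπ : M.Feasible π) (i : Fin 2) :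
    Measurable fun ω => if M.finalDec π ω = i then
      ENNReal.ofReal ((M.finalEst π i ω - M.Θ ω) ^ 2) else 0 :=
  Measurable.ite (measurable_finalDec hπ (measurableSet_singleton _))
    (((measurable_finalEst hπ i).sub M.measurable_Θ).pow_const 2).ennreal_ofReal measurable_const

theorem lintegral_est_sub_sq_ne_top {M : Model P 𝒳 T} {π : Policy 𝒳}
    (hm : M.UsesPosteriorMeans π) (i : Fin 2) {n : ℕ} (hn : n ≤ M.N) :
    ∫⁻ ω, ENNReal.ofReal ((π.est i n (M.obs n ω) - M.Θ ω) ^ 2) ∂(M.condH i) ≠ ⊤ := by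
  have hL := (((M.memLp_condH i).condExp (m := MeasurableSpace.comap (M.obs n) inferInstance)
    (by norm_num)).ae_eq (hm i n hn).symm).sub (M.memLp_condH i)
  have h := hL.integrable_sq.lintegral_lt_top.ne
  exact h

theorem sqErr_le {M : Model P 𝒳 T} {π : Policy 𝒳} (hπ : M.Feasible π) (i : Fin 2) (ω : Ω) :
    (if M.finalDec π ω = i then ENNReal.ofReal ((M.finalEst π i ω - M.Θ ω) ^ 2) else 0) ≤
      ∑ n ∈ Finset.range (M.N + 1), ENNReal.ofReal ((π.est i n (M.obs n ω) - M.Θ ω) ^ 2) := by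
  have h := Finset.single_le_sum
    (f := fun n => ENNReal.ofReal ((π.est i n (M.obs n ω) - M.Θ ω) ^ 2))
    (fun _ _ => zero_le) (Finset.mem_range_succ_iff.2 (runLength_le hπ ω))
  split_ifs
  · exact h
  · exact zero_le

theorem errProb_eq_lintegral {M : Model P 𝒳 T} {π : Policy 𝒳} (hπ : M.Feasible π) (i : Fin 2) :
    M.errProb π i = ∫⁻ ω, (if M.finalDec π ω = 1 - i then 1 else 0) ∂(M.condH i) := by
  have h : MeasurableSet {ω | M.finalDec π ω = 1 - i} :=
    measurable_finalDec hπ (measurableSet_singleton _)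
  rw [errProb, ← lintegral_indicator_one h]
  refine lintegral_congr fun ω => ?_
  classical
  simp [Set.indicator_apply]

/-- Summing over all times removes the dependence on the stopping rule, so one integrable bound
serves the optimal policies for all weights. -/
theorem lintegral_sum_est_sub_sq_ne_top {M : Model P 𝒳 T} {π : Policy 𝒳} (hπ : M.Feasible π)
    (hm : M.UsesPosteriorMeans π) (i : Fin 2) :
    ∫⁻ ω, ∑ n ∈ Finset.range (M.N + 1), ENNReal.ofReal ((π.est i n (M.obs n ω) - M.Θ ω) ^ 2)
      ∂(M.condH i) ≠ ⊤ := by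
  rw [lintegral_finsetSum]
  · refine (ENNReal.sum_lt_top.2 fun n hn => ?_).ne
    exact (lintegral_est_sub_sq_ne_top hm i (Finset.mem_range_succ_iff.1 hn)).lt_top
  · intro n hn
    exact ((((hπ.measurable_est i n (Finset.mem_range_succ_iff.1 hn)).comp
      (M.measurable_obs n)).sub M.measurable_Θ).pow_const 2).ennreal_ofReal

theorem estErr_ne_top {M : Model P 𝒳 T} {π : Policy 𝒳} (hπ : M.Feasible π)
    (hm : M.UsesPosteriorMeans π) (i : Fin 2) : M.estErr π i ≠ ⊤ := by
  rw [estErr_eq_lintegral hπ]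
  exact ne_top_of_le_ne_top (lintegral_sum_est_sub_sq_ne_top hπ hm i)
    (lintegral_mono fun ω => sqErr_le hπ i ω)

variable [IsProbabilityMeasure P]

/-! ### Continuity in the weights -/

theorem tendsto_decCost (M : Model P 𝒳 T) {Cs : ℕ → Fin 4 → ℝ} {C : Fin 4 → ℝ}
    (hlim : Tendsto Cs atTop (𝓝 C)) (n : ℕ) (i : Fin 2) (t : T) :
    Tendsto (fun k => M.decCost (Cs k) n i t) atTop (𝓝 (M.decCost C n i t)) := by
  have h := tendsto_pi_nhds.1 hlim
  exact ((h _).mul_const _).add (((h _).mul_const _).mul_const _)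

theorem tendsto_stopCost (M : Model P 𝒳 T) {Cs : ℕ → Fin 4 → ℝ} {C : Fin 4 → ℝ}
    (hlim : Tendsto Cs atTop (𝓝 C)) (n : ℕ) (t : T) :
    Tendsto (fun k => M.stopCost (Cs k) n t) atTop (𝓝 (M.stopCost C n t)) :=
  (M.tendsto_decCost hlim n 0 t).min (M.tendsto_decCost hlim n 1 t)

/-- Dominated convergence under the predictive law. Costs increase with the weights, and eventually
`Cs k ≤ C + 1`, so `D_0` for the weights `C + 1` dominates. -/
theorem ae_tendsto_contCost_of_rho (M : Model P 𝒳 T) {Cs : ℕ → Fin 4 → ℝ} (hCs : ∀ k, 0 ≤ Cs k)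
    {C : Fin 4 → ℝ} (hC : 0 ≤ C) (hlim : Tendsto Cs atTop (𝓝 C)) {n : ℕ} (hn : n < M.N)
    (h : ∀ᵐ ω ∂P, Tendsto (fun k => M.rho (Cs k) (n + 1) (M.stat (n + 1) ω)) atTop
      (𝓝 (M.rho C (n + 1) (M.stat (n + 1) ω)))) :
    ∀ᵐ ω ∂P, Tendsto (fun k => M.contCost (Cs k) n (M.stat n ω)) atTop
      (𝓝 (M.contCost C n (M.stat n ω))) := by
  have hs : MeasurableSet {t | Tendsto (fun k => M.rho (Cs k) (n + 1) t) atTop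
      (𝓝 (M.rho C (n + 1) t))} :=
    measurableSet_tendsto_fun (fun k => M.measurable_rho (Cs k) (n + 1))
      (M.measurable_rho C (n + 1))
  have hC1 : 0 ≤ C + 1 := add_nonneg hC zero_le_one
  have hle : ∀ᶠ k in atTop, Cs k ≤ C + 1 := by
    have : ∀ j, ∀ᶠ k in atTop, Cs k j ≤ C j + 1 := fun j =>
      (tendsto_pi_nhds.1 hlim j).eventually_le_const (lt_add_one _)
    filter_upwards [eventually_all.2 this] with k hk j using hk j
  filter_upwards [M.ae_predictive hn hs h, M.ae_integrable_decCost hC1 hn 0] with ω h1 h2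
  refine Tendsto.const_add 1 (tendsto_integral_filter_of_dominated_convergence _
    (Eventually.of_forall fun k => ?_) ?_ h2 h1)
  · exact ((M.measurable_rho (Cs k) (n + 1)).comp
      (M.measurable_ξ.comp measurable_prodMk_left)).aestronglyMeasurable
  · filter_upwards [hle] with k hk
    refine ae_of_all _ fun x => ?_
    rw [Real.norm_of_nonneg (M.rho_nonneg (hCs k) _ _)]
    exact (M.rho_le_stopCost _ _ _).trans ((M.stopCost_le _ _ 0 _).trans (M.decCost_mono hk _ _ _))

theorem ae_tendsto_rho (M : Model P 𝒳 T) {Cs : ℕ → Fin 4 → ℝ} (hCs : ∀ k, 0 ≤ Cs k)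
    {C : Fin 4 → ℝ} (hC : 0 ≤ C) (hlim : Tendsto Cs atTop (𝓝 C)) (m : ℕ) {n : ℕ}
    (hn : n + m = M.N) :
    ∀ᵐ ω ∂P, Tendsto (fun k => M.rho (Cs k) n (M.stat n ω)) atTop
      (𝓝 (M.rho C n (M.stat n ω))) := by
  induction m generalizing n with
  | zero =>
    rw [add_zero] at hn
    subst hn
    simp only [rho_last]
    exact ae_of_all _ fun ω => M.tendsto_stopCost hlim _ _
  | succ m ih =>
    have hn' : n < M.N := by omega
    simp only [M.rho_of_lt _ hn']
    filter_upwards [M.ae_tendsto_contCost_of_rho hCs hC hlim hn' (ih (by omega))] with ω hω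
    exact (M.tendsto_stopCost hlim _ _).min hω

theorem ae_tendsto_contCost (M : Model P 𝒳 T) {Cs : ℕ → Fin 4 → ℝ} (hCs : ∀ k, 0 ≤ Cs k)
    {C : Fin 4 → ℝ} (hC : 0 ≤ C) (hlim : Tendsto Cs atTop (𝓝 C)) {n : ℕ} (hn : n < M.N) :
    ∀ᵐ ω ∂P, Tendsto (fun k => M.contCost (Cs k) n (M.stat n ω)) atTop
      (𝓝 (M.contCost C n (M.stat n ω))) :=
  M.ae_tendsto_contCost_of_rho hCs hC hlim hn
    (M.ae_tendsto_rho hCs hC hlim (M.N - (n + 1)) (by omega))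

/-- Along a fixed outcome, finitely many strict inequalities determine the run and the decision;
each survives a small change of the costs. -/
theorem FollowsOptimal.eventually_eq {M : Model P 𝒳 T} {Cs : ℕ → Fin 4 → ℝ} {C : Fin 4 → ℝ}
    (hlim : Tendsto Cs atTop (𝓝 C)) {π : Policy 𝒳} (hπ : M.Feasible π) {ω : Ω}
    (h : M.FollowsOptimal C π ω)
    (hω : ∀ n < M.N, Tendsto (fun k => M.contCost (Cs k) n (M.stat n ω)) atTop
      (𝓝 (M.contCost C n (M.stat n ω)))) :
    ∀ᶠ k in atTop, M.runLength (M.optPolicy (Cs k)) ω = M.runLength π ω ∧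
      M.finalDec (M.optPolicy (Cs k)) ω = M.finalDec π ω := by
  have hτN := runLength_le hπ ω
  set τ := M.runLength π ω with hτ
  obtain ⟨h1, h2, h3, h4⟩ : _ ∧ _ ∧ _ ∧ _ := ⟨h.1, h.2 τ rfl⟩
  have e1 : ∀ᶠ k in atTop, ∀ n < τ,
      M.contCost (Cs k) n (M.stat n ω) < M.stopCost (Cs k) n (M.stat n ω) :=
    (Set.finite_Iio τ).eventually_all.2 fun n hn =>
      (hω n (lt_of_lt_of_le hn hτN)).eventually_lt (M.tendsto_stopCost hlim _ _) (h1 n hn)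
  have e2 : ∀ᶠ k in atTop, τ < M.N →
      M.stopCost (Cs k) τ (M.stat τ ω) < M.contCost (Cs k) τ (M.stat τ ω) := by
    by_cases hN : τ < M.N
    · filter_upwards [(M.tendsto_stopCost hlim _ _).eventually_lt (hω τ hN) (h2 hN)] with k hk _
      exact hk
    · exact Eventually.of_forall fun _ h => absurd h hN
  have e3 : ∀ᶠ k in atTop, (M.optPolicy (Cs k)).dec τ (M.obs τ ω) = M.finalDec π ω := by
    have hd : ∀ d : Fin 2, d = M.finalDec π ω → ∀ᶠ k in atTop,
        (if M.decCost (Cs k) τ 0 (M.stat τ ω) ≤ M.decCost (Cs k) τ 1 (M.stat τ ω) then 0 else 1) =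
          d := by
      intro d hd
      rw [← hd, stopCost] at h3
      fin_cases d
      · have : M.decCost C τ 0 (M.stat τ ω) < M.decCost C τ 1 (M.stat τ ω) :=
          lt_of_le_of_ne (h3.trans_le (min_le_right _ _)) h4
        filter_upwards [(M.tendsto_decCost hlim _ _ _).eventually_lt
          (M.tendsto_decCost hlim _ _ _) this] with k hk
        exact if_pos hk.le
      · have : M.decCost C τ 1 (M.stat τ ω) < M.decCost C τ 0 (M.stat τ ω) :=
          lt_of_le_of_ne (h3.trans_le (min_le_left _ _)) h4.symm
        filter_upwards [(M.tendsto_decCost hlim _ _ _).eventually_lt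
          (M.tendsto_decCost hlim _ _ _) this] with k hk
        exact if_neg (not_le.2 hk)
    simpa only [optPolicy, statOf_obs] using hd _ rfl
  filter_upwards [e1, e2, e3] with k k1 k2 k3
  have hf := M.feasible_optPolicy (Cs k)
  have hr : M.runLength (M.optPolicy (Cs k)) ω = τ := by
    rw [runLength_eq_iff hf, le_runLength_iff hf]
    refine ⟨fun n hn => ?_, ?_⟩
    · rw [← Bool.not_eq_true, optPolicy_halt_iff, not_or, not_le, not_le]
      exact ⟨hn.trans_le hτN, k1 n hn⟩
    · rw [optPolicy_halt_iff]
      exact hτN.eq_or_lt.imp (fun h => h.ge) fun h => (k2 h).le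
  exact ⟨hr, (finalDec_of_runLength_eq hr).trans k3⟩

theorem ae_condH_of_ae (M : Model P 𝒳 T) (i : Fin 2) {p : Ω → Prop} (h : ∀ᵐ ω ∂P, p ω) :
    ∀ᵐ ω ∂(M.condH i), p ω :=
  (M.ae_condH_iff i).2 (h.mono fun _ h _ => h)

/-! ### Error probabilities and mean squared errors -/

theorem errProb_ne_top (M : Model P 𝒳 T) (π : Policy 𝒳) (i : Fin 2) : M.errProb π i ≠ ⊤ :=
  measure_ne_top _ _

theorem ae_eventually_optPolicy_eq (M : Model P 𝒳 T) {Cs : ℕ → Fin 4 → ℝ} (hCs : ∀ k, 0 ≤ Cs k)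
    {C : Fin 4 → ℝ} (hC : 0 ≤ C) (hties : M.NoTies C) (hlim : Tendsto Cs atTop (𝓝 C)) :
    ∀ᵐ ω ∂P, ∀ᶠ k in atTop,
      M.finalDec (M.optPolicy (Cs k)) ω = M.finalDec (M.optPolicy C) ω ∧
      ∀ i, M.finalEst (M.optPolicy (Cs k)) i ω = M.finalEst (M.optPolicy C) i ω := by
  have h1 : ∀ᵐ ω ∂P, ∀ n, n < M.N → Tendsto (fun k => M.contCost (Cs k) n (M.stat n ω)) atTop
      (𝓝 (M.contCost C n (M.stat n ω))) := ae_all_iff.2 fun n => by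
    by_cases hn : n < M.N
    · filter_upwards [M.ae_tendsto_contCost hCs hC hlim hn] with ω hω _ using hω
    · exact ae_of_all _ fun _ h => absurd h hn
  filter_upwards [h1, (M.isOptimalPolicy_optPolicy hC).1.ae_followsOptimal hC hties] with ω h1 h2
  filter_upwards [h2.eventually_eq hlim (M.feasible_optPolicy C) h1] with k hk
  refine ⟨hk.2, fun i => ?_⟩
  -- At equal stopping times the estimates coincide because `postEst` does not involve the weights.
  rw [finalEst_of_runLength_eq hk.1, finalEst_of_runLength_eq rfl]
  rfl

theorem tendsto_errProb (M : Model P 𝒳 T) {Cs : ℕ → Fin 4 → ℝ} (hCs : ∀ k, 0 ≤ Cs k)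
    {C : Fin 4 → ℝ} (hC : 0 ≤ C) (hties : M.NoTies C) (hlim : Tendsto Cs atTop (𝓝 C))
    (i : Fin 2) : Tendsto (fun k => M.errProb (M.optPolicy (Cs k)) i) atTop
      (𝓝 (M.errProb (M.optPolicy C) i)) := by
  simp only [errProb_eq_lintegral (M.feasible_optPolicy _)]
  refine tendsto_lintegral_of_dominated_convergence' (fun _ => 1)
    (fun k => (measurable_decErr (M.feasible_optPolicy _) _).aemeasurable)
    (fun k => ae_of_all _ fun ω => ?_) (by simp) ?_
  · dsimp only
    split_ifs <;> simp
  · have h := M.ae_condH_of_ae i (M.ae_eventually_optPolicy_eq hCs hC hties hlim)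
    filter_upwards [h] with ω hω
    refine tendsto_const_nhds.congr' ?_
    filter_upwards [hω] with k hk
    rw [hk.1]

theorem tendsto_estErr (M : Model P 𝒳 T) {Cs : ℕ → Fin 4 → ℝ} (hCs : ∀ k, 0 ≤ Cs k)
    {C : Fin 4 → ℝ} (hC : 0 ≤ C) (hties : M.NoTies C) (hlim : Tendsto Cs atTop (𝓝 C))
    (i : Fin 2) : Tendsto (fun k => M.estErr (M.optPolicy (Cs k)) i) atTop
      (𝓝 (M.estErr (M.optPolicy C) i)) := by
  simp only [estErr_eq_lintegral (M.feasible_optPolicy _)]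
  refine tendsto_lintegral_of_dominated_convergence' _
    (fun k => (measurable_sqErr (M.feasible_optPolicy _) _).aemeasurable)
    (fun k => ae_of_all _ fun ω => sqErr_le (M.feasible_optPolicy (Cs k)) i ω)
    (lintegral_sum_est_sub_sq_ne_top (M.feasible_optPolicy C) (M.optPolicy_usesPosteriorMeans C) i)
    ?_
  have h := M.ae_condH_of_ae i (M.ae_eventually_optPolicy_eq hCs hC hties hlim)
  filter_upwards [h] with ω hω
  refine tendsto_const_nhds.congr' ?_
  filter_upwards [hω] with k hk
  rw [hk.1, hk.2]

/-! ### The objective as a function of the weights -/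

theorem lintegral_eq_sum_condH (M : Model P 𝒳 T) (f : Ω → ENNReal) :
    ∫⁻ ω, f ω ∂P = ∑ i, ENNReal.ofReal (M.prior i) * ∫⁻ ω, f ω ∂(M.condH i) := by
  have h : ∀ i, ENNReal.ofReal (M.prior i) * ∫⁻ ω, f ω ∂(M.condH i) =
      ∫⁻ ω in M.H ⁻¹' {i}, f ω ∂P := fun i => by
    rw [prior, ofReal_measureReal, condH, ProbabilityTheory.cond, lintegral_smul_measure,
      smul_eq_mul, ← mul_assoc, ENNReal.mul_inv_cancel (M.prior_pos i).ne' (measure_ne_top _ _),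
      one_mul]
  simp only [h, Fin.sum_univ_two]
  rw [← lintegral_add_compl f (M.measurable_H (measurableSet_singleton 0))]
  congr 3
  ext ω
  simp only [Set.mem_compl_iff, Set.mem_preimage, Set.mem_singleton_iff]
  generalize M.H ω = h
  revert h; decide

theorem ofReal_expRunLength {M : Model P 𝒳 T} {π : Policy 𝒳} (hπ : M.Feasible π) :
    ENNReal.ofReal (M.expRunLength π) = ∫⁻ ω, (M.runLength π ω : ENNReal) ∂P := by
  have hm : Measurable fun ω => (M.runLength π ω : ℝ) :=
    (measurable_of_countable (fun n : ℕ => (n : ℝ))).comp (measurable_runLength hπ)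
  rw [expRunLength, ofReal_integral_eq_lintegral_ofReal _ (ae_of_all _ fun _ => Nat.cast_nonneg _)]
  · simp
  · refine Integrable.of_bound (C := M.N) hm.aestronglyMeasurable (ae_of_all _ fun ω => ?_)
    rw [Real.norm_of_nonneg (Nat.cast_nonneg _)]
    exact_mod_cast runLength_le hπ ω

/-- Conditioning on the hypothesis splits the loss into the constrained quantities and shows that
the objective is affine in the weights. -/
theorem objective_eq_sum {M : Model P 𝒳 T} {π : Policy 𝒳} (hπ : M.Feasible π)
    {C : Fin 4 → ℝ} (hC : 0 ≤ C) :
    M.objective C π = ENNReal.ofReal (M.expRunLength π) + ∑ i, ENNReal.ofReal (M.prior i) *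
      (ENNReal.ofReal (C (det i)) * M.errProb π i + ENNReal.ofReal (C (mse i)) * M.estErr π i) := by
  have hτ : Measurable fun ω => (M.runLength π ω : ENNReal) :=
    (measurable_of_countable (fun n : ℕ => (n : ENNReal))).comp (measurable_runLength hπ)
  have h1 : M.objective C π = ∫⁻ ω, ((M.runLength π ω : ENNReal) + ENNReal.ofReal
      (jointLoss C (M.finalDec π ω) (fun i => M.finalEst π i ω) (M.H ω) (M.Θ ω))) ∂P :=
    lintegral_congr fun ω => by
      rw [ENNReal.ofReal_add (Nat.cast_nonneg _) (jointLoss_nonneg hC _ _ _ _),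
        ENNReal.ofReal_natCast]
  rw [h1, lintegral_add_left hτ, ofReal_expRunLength hπ]
  congr 1
  rw [M.lintegral_eq_sum_condH]
  refine Finset.sum_congr rfl fun i _ => ?_
  congr 1
  rw [errProb_eq_lintegral hπ, estErr_eq_lintegral hπ,
    ← lintegral_const_mul _ (measurable_decErr hπ _), ← lintegral_const_mul _ (measurable_sqErr hπ _),
    ← lintegral_add_left ((measurable_decErr hπ _).const_mul _)]
  refine lintegral_congr_ae ?_
  have hH : ∀ᵐ ω ∂(M.condH i), M.H ω = i := (M.ae_condH_iff i).2 (ae_of_all _ fun _ h => h)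
  filter_upwards [hH] with ω hω
  rw [hω, jointLoss]
  by_cases hd : M.finalDec π ω = i
  · have : ∀ j : Fin 2, j ≠ 1 - j := by decide
    rw [hd, if_pos rfl, if_pos rfl, if_neg (this i), mul_zero, zero_add,
      ← ENNReal.ofReal_mul (hC _)]
    congr 1
    ring
  · rw [if_neg hd, if_neg hd, if_pos (fin_two_ne_iff.1 hd), mul_zero, mul_one, add_zero]

end Model

namespace Model

variable {Ω : Type*} [MeasurableSpace Ω] {P : Measure Ω}
  {𝒳 : Type*} [MeasurableSpace 𝒳] {T : Type*} [MeasurableSpace T]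

open Filter Topology

/-! ### Duality -/

/-- The vector of error probabilities and mean squared errors of `π`. -/
def errVec (M : Model P 𝒳 T) (π : Policy 𝒳) : Fin 4 → ℝ :=
  Fin.append (fun i => (M.errProb π i).toReal) (fun i => (M.estErr π i).toReal)

/-- The prior probabilities, indexed like the weights. -/
def priorVec (M : Model P 𝒳 T) : Fin 4 → ℝ := Fin.append M.prior M.prior

theorem errVec_det (M : Model P 𝒳 T) (π : Policy 𝒳) (i : Fin 2) :
    M.errVec π (det i) = (M.errProb π i).toReal := Fin.append_left _ _ _

theorem errVec_mse (M : Model P 𝒳 T) (π : Policy 𝒳) (i : Fin 2) :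
    M.errVec π (mse i) = (M.estErr π i).toReal := Fin.append_right _ _ _

theorem priorVec_det (M : Model P 𝒳 T) (i : Fin 2) : M.priorVec (det i) = M.prior i :=
  Fin.append_left _ _ _

theorem priorVec_mse (M : Model P 𝒳 T) (i : Fin 2) : M.priorVec (mse i) = M.prior i :=
  Fin.append_right _ _ _

theorem sum_det_add_sum_mse (f : Fin 4 → ℝ) :
    ∑ j, f j = ∑ i, f (det i) + ∑ i, f (mse i) := Fin.sum_univ_add (a := 2) (b := 2) f

theorem forall_det_mse {p : Fin 4 → Prop} (h : ∀ i, p (det i)) (h' : ∀ i, p (mse i)) :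
    ∀ j, p j := Fin.addCases (m := 2) (n := 2) h h'

theorem errVec_nonneg (M : Model P 𝒳 T) (π : Policy 𝒳) : ∀ j, 0 ≤ M.errVec π j :=
  forall_det_mse (fun i => by rw [errVec_det]; exact ENNReal.toReal_nonneg)
    (fun i => by rw [errVec_mse]; exact ENNReal.toReal_nonneg)

theorem expRunLength_nonneg (M : Model P 𝒳 T) (π : Policy 𝒳) : 0 ≤ M.expRunLength π :=
  integral_nonneg fun _ => Nat.cast_nonneg _

theorem MeetsConstraints.estErr_ne_top {M : Model P 𝒳 T} {γ : Fin 4 → ℝ} {π : Policy 𝒳}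
    (h : M.MeetsConstraints γ π) (i : Fin 2) : M.estErr π i ≠ ⊤ :=
  ne_top_of_le_ne_top ENNReal.ofReal_ne_top (h i).2

variable [IsProbabilityMeasure P]

theorem prior_pos' (M : Model P 𝒳 T) (i : Fin 2) : 0 < M.prior i :=
  ENNReal.toReal_pos (M.prior_pos i).ne' (measure_ne_top _ _)

theorem priorVec_pos (M : Model P 𝒳 T) : ∀ j, 0 < M.priorVec j :=
  forall_det_mse (fun i => by rw [priorVec_det]; exact M.prior_pos' i)
    (fun i => by rw [priorVec_mse]; exact M.prior_pos' i)

theorem dual_eq (M : Model P 𝒳 T) (γ C : Fin 4 → ℝ) :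
    M.dual γ C = M.rho C 0 M.t₀ - ∑ j, M.priorVec j * C j * γ j := by
  rw [dual, sum_det_add_sum_mse]
  simp only [priorVec_det, priorVec_mse]
  ring

/-- Finite mean squared errors are essential for the real-valued form, since `ENNReal.toReal` sends
an infinite error to zero. -/
theorem objective_eq_ofReal {M : Model P 𝒳 T} {π : Policy 𝒳} (hπ : M.Feasible π)
    (hfin : ∀ i, M.estErr π i ≠ ⊤) {C : Fin 4 → ℝ} (hC : 0 ≤ C) :
    M.objective C π =
      ENNReal.ofReal (M.expRunLength π + ∑ j, M.priorVec j * C j * M.errVec π j) := by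
  have hp : ∀ i, 0 ≤ M.prior i := fun i => (M.prior_pos' i).le
  have hC' : ∀ j, 0 ≤ C j := hC
  have h1 : ∀ i, ENNReal.ofReal (M.prior i) * (ENNReal.ofReal (C (det i)) * M.errProb π i +
      ENNReal.ofReal (C (mse i)) * M.estErr π i) = ENNReal.ofReal
        (M.prior i * C (det i) * (M.errProb π i).toReal +
          M.prior i * C (mse i) * (M.estErr π i).toReal) := fun i => by
    have h1 : 0 ≤ (M.errProb π i).toReal := ENNReal.toReal_nonneg
    have h2 : 0 ≤ (M.estErr π i).toReal := ENNReal.toReal_nonneg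
    have h3 := hp i
    have h4 := hC' (det i)
    have h5 := hC' (mse i)
    rw [ENNReal.ofReal_add (by positivity) (by positivity), mul_assoc, mul_assoc,
      ENNReal.ofReal_mul h3, ENNReal.ofReal_mul h3, ENNReal.ofReal_mul h4, ENNReal.ofReal_mul h5,
      ENNReal.ofReal_toReal (M.errProb_ne_top π i), ENNReal.ofReal_toReal (hfin i), mul_add]
  have h2 : ∀ i, 0 ≤ M.prior i * C (det i) * (M.errProb π i).toReal +
      M.prior i * C (mse i) * (M.estErr π i).toReal := fun i =>
    add_nonneg (mul_nonneg (mul_nonneg (hp i) (hC' _)) ENNReal.toReal_nonneg)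
      (mul_nonneg (mul_nonneg (hp i) (hC' _)) ENNReal.toReal_nonneg)
  rw [objective_eq_sum hπ hC, Finset.sum_congr rfl fun i _ => h1 i,
    ← ENNReal.ofReal_sum_of_nonneg fun i _ => h2 i,
    ← ENNReal.ofReal_add (M.expRunLength_nonneg π) (Finset.sum_nonneg fun i _ => h2 i),
    Finset.sum_add_distrib, sum_det_add_sum_mse]
  simp only [priorVec_det, priorVec_mse, errVec_det, errVec_mse]

theorem lagrangian_nonneg (M : Model P 𝒳 T) (π : Policy 𝒳) {C : Fin 4 → ℝ} (hC : 0 ≤ C) :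
    0 ≤ M.expRunLength π + ∑ j, M.priorVec j * C j * M.errVec π j :=
  add_nonneg (M.expRunLength_nonneg π) (Finset.sum_nonneg fun j _ =>
    mul_nonneg (mul_nonneg (M.priorVec_pos j).le (hC j)) (M.errVec_nonneg π j))

theorem rho_le_lagrangian {M : Model P 𝒳 T} {π : Policy 𝒳} (hπ : M.Feasible π)
    (hfin : ∀ i, M.estErr π i ≠ ⊤) {C : Fin 4 → ℝ} (hC : 0 ≤ C) :
    M.rho C 0 M.t₀ ≤ M.expRunLength π + ∑ j, M.priorVec j * C j * M.errVec π j := by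
  have h := le_objective hπ hC
  rwa [objective_eq_ofReal hπ hfin hC, ENNReal.ofReal_le_ofReal_iff (M.lagrangian_nonneg π hC)] at h

theorem minimizes_iff_lagrangian_le {M : Model P 𝒳 T} {π : Policy 𝒳} (hπ : M.Feasible π)
    (hfin : ∀ i, M.estErr π i ≠ ⊤) {C : Fin 4 → ℝ} (hC : 0 ≤ C) :
    M.Minimizes C π ↔
      M.expRunLength π + ∑ j, M.priorVec j * C j * M.errVec π j ≤ M.rho C 0 M.t₀ := by
  rw [minimizes_iff M hC, and_iff_right hπ, objective_eq_ofReal hπ hfin hC,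
    ENNReal.ofReal_le_ofReal_iff (M.rho_nonneg hC _ _)]

theorem Minimizes.lagrangian_eq {M : Model P 𝒳 T} {π : Policy 𝒳} {C : Fin 4 → ℝ} (hC : 0 ≤ C)
    (h : M.Minimizes C π) (hfin : ∀ i, M.estErr π i ≠ ⊤) :
    M.expRunLength π + ∑ j, M.priorVec j * C j * M.errVec π j = M.rho C 0 M.t₀ :=
  le_antisymm ((minimizes_iff_lagrangian_le h.1 hfin hC).1 h) (rho_le_lagrangian h.1 hfin hC)

theorem estErr_optPolicy_ne_top (M : Model P 𝒳 T) (C : Fin 4 → ℝ) (i : Fin 2) :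
    M.estErr (M.optPolicy C) i ≠ ⊤ :=
  estErr_ne_top (M.feasible_optPolicy C) (M.optPolicy_usesPosteriorMeans C) i

/-- `L_γ` lies below its tangent at weights where it is evaluated by an optimal policy. -/
theorem sum_sub_mul_le_dual_sub (M : Model P 𝒳 T) (γ : Fin 4 → ℝ) {C C' : Fin 4 → ℝ} (hC : 0 ≤ C)
    (hC' : 0 ≤ C') : ∑ j, M.priorVec j * (C' j - C j) * (M.errVec (M.optPolicy C') j - γ j) ≤
      M.dual γ C' - M.dual γ C := by
  have h1 := (M.isOptimalPolicy_optPolicy hC').1.lagrangian_eq hC' (M.estErr_optPolicy_ne_top C')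
  -- The policy optimal for `C'` is merely a competitor for `C`.
  have h2 := rho_le_lagrangian (M.feasible_optPolicy C') (M.estErr_optPolicy_ne_top C') hC
  have h3 : ∑ j, M.priorVec j * (C' j - C j) * (M.errVec (M.optPolicy C') j - γ j) =
      ∑ j, M.priorVec j * C' j * M.errVec (M.optPolicy C') j -
      ∑ j, M.priorVec j * C j * M.errVec (M.optPolicy C') j -
      (∑ j, M.priorVec j * C' j * γ j - ∑ j, M.priorVec j * C j * γ j) := by
    rw [← Finset.sum_sub_distrib, ← Finset.sum_sub_distrib, ← Finset.sum_sub_distrib]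
    exact Finset.sum_congr rfl fun j _ => by ring
  rw [dual_eq, dual_eq, h3]
  linarith

theorem tendsto_errVec (M : Model P 𝒳 T) {Cs : ℕ → Fin 4 → ℝ} (hCs : ∀ k, 0 ≤ Cs k)
    {C : Fin 4 → ℝ} (hC : 0 ≤ C) (hties : M.NoTies C) (hlim : Tendsto Cs atTop (𝓝 C))
    (j : Fin 4) : Tendsto (fun k => M.errVec (M.optPolicy (Cs k)) j) atTop
      (𝓝 (M.errVec (M.optPolicy C) j)) := by
  revert j
  refine forall_det_mse (fun i => ?_) (fun i => ?_)
  · simp only [errVec_det]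
    exact (ENNReal.tendsto_toReal (M.errProb_ne_top _ i)).comp
      (M.tendsto_errProb hCs hC hties hlim i)
  · simp only [errVec_mse]
    exact (ENNReal.tendsto_toReal (M.estErr_optPolicy_ne_top C i)).comp
      (M.tendsto_estErr hCs hC hties hlim i)

/-- Perturbing one coordinate of a maximizer of `L_γ`. -/
theorem mul_errVec_sub_nonpos (M : Model P 𝒳 T) {γ C : Fin 4 → ℝ} (hC : 0 ≤ C)
    (hmax : ∀ C' : Fin 4 → ℝ, 0 ≤ C' → M.dual γ C' ≤ M.dual γ C) (j : Fin 4) {s : ℝ}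
    (hs : 0 ≤ C j + s) :
    0 ≤ C + Pi.single j s ∧ s * (M.errVec (M.optPolicy (C + Pi.single j s)) j - γ j) ≤ 0 := by
  have hC' : 0 ≤ C + Pi.single j s := fun l => by
    by_cases h : l = j
    · subst h; simpa using hs
    · simpa [h] using hC l
  refine ⟨hC', ?_⟩
  have h := M.sum_sub_mul_le_dual_sub γ hC hC'
  rw [Finset.sum_eq_single j (fun l _ hl => by simp [hl]) (by simp)] at h
  simp only [Pi.add_apply, Pi.single_eq_same, add_sub_cancel_left] at h
  have h2 := h.trans (sub_nonpos.2 (hmax _ hC'))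
  rw [mul_assoc] at h2
  exact nonpos_of_mul_nonpos_right h2 (M.priorVec_pos j)

/-- The first-order condition at the maximizer, obtained by shrinking the perturbation with factors
`1 / (k + 1)` and using convergence of the errors. -/
theorem mul_errVec_optPolicy_sub_nonpos (M : Model P 𝒳 T) {γ C : Fin 4 → ℝ} (hC : 0 ≤ C)
    (hmax : ∀ C' : Fin 4 → ℝ, 0 ≤ C' → M.dual γ C' ≤ M.dual γ C) (hties : M.NoTies C)
    (j : Fin 4) {s : ℝ} (hs : 0 ≤ C j + s) :
    s * (M.errVec (M.optPolicy C) j - γ j) ≤ 0 := by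
  have hδ : ∀ k : ℕ, 0 < 1 / ((k : ℝ) + 1) ∧ 1 / ((k : ℝ) + 1) ≤ 1 := fun k =>
    ⟨Nat.one_div_pos_of_nat, by
      rw [div_le_one (by positivity)]; linarith [(Nat.cast_nonneg k : (0 : ℝ) ≤ k)]⟩
  -- A convex combination of the nonnegative numbers `C j` and `C j + s`.
  have hs' : ∀ k : ℕ, 0 ≤ C j + s * (1 / ((k : ℝ) + 1)) := fun k => by
    have h1 := hδ k
    have h2 := hC j
    simp only [Pi.zero_apply] at h2
    nlinarith
  have hlim : Tendsto (fun k : ℕ => C + Pi.single j (s * (1 / ((k : ℝ) + 1)))) atTop (𝓝 C) := by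
    have h1 : Tendsto (fun k : ℕ => s * (1 / ((k : ℝ) + 1))) atTop (𝓝 0) := by
      simpa using tendsto_one_div_add_atTop_nhds_zero_nat.const_mul s
    have h2 := ((continuous_single (A := fun _ : Fin 4 => ℝ) j).tendsto 0).comp h1
    simpa using h2.const_add C
  have h := M.tendsto_errVec (fun k => (M.mul_errVec_sub_nonpos hC hmax j (hs' k)).1) hC hties hlim j
  refine le_of_tendsto ((h.sub_const (γ j)).const_mul s) (Eventually.of_forall fun k => ?_)
  have h2 := (M.mul_errVec_sub_nonpos hC hmax j (hs' k)).2
  rw [mul_right_comm] at h2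
  exact nonpos_of_mul_nonpos_left h2 (hδ k).1

theorem errVec_optPolicy_le (M : Model P 𝒳 T) {γ C : Fin 4 → ℝ} (hC : 0 ≤ C)
    (hmax : ∀ C' : Fin 4 → ℝ, 0 ≤ C' → M.dual γ C' ≤ M.dual γ C) (hties : M.NoTies C)
    (j : Fin 4) : M.errVec (M.optPolicy C) j ≤ γ j := by
  have h := M.mul_errVec_optPolicy_sub_nonpos hC hmax hties j (s := 1) (add_nonneg (hC j) zero_le_one)
  linarith

theorem complementary_slackness (M : Model P 𝒳 T) {γ C : Fin 4 → ℝ} (hC : 0 ≤ C)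
    (hmax : ∀ C' : Fin 4 → ℝ, 0 ≤ C' → M.dual γ C' ≤ M.dual γ C) (hties : M.NoTies C)
    (j : Fin 4) : C j * M.errVec (M.optPolicy C) j = C j * γ j := by
  -- Moving the weight all the way to zero gives the reverse of the feasibility inequality,
  -- multiplied by `C j`.
  have h := M.mul_errVec_optPolicy_sub_nonpos hC hmax hties j (s := -C j) (by simp)
  have h2 := mul_le_mul_of_nonneg_left (M.errVec_optPolicy_le hC hmax hties j) (hC j)
  linarith

/-! ### Comparison of optimal policies -/

theorem Minimizes.ae_eq {M : Model P 𝒳 T} {C : Fin 4 → ℝ} (hC : 0 ≤ C) (hties : M.NoTies C)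
    {π π' : Policy 𝒳} (h : M.Minimizes C π) (h' : M.Minimizes C π') :
    ∀ᵐ ω ∂P, M.runLength π ω = M.runLength π' ω ∧ M.finalDec π ω = M.finalDec π' ω := by
  filter_upwards [h.ae_followsOptimal hC hties, h'.ae_followsOptimal hC hties] with ω h1 h2
  exact h1.eq h.1 h'.1 h2

theorem UsesPosteriorMeans.ae_finalEst_eq {M : Model P 𝒳 T} {π : Policy 𝒳} (hπ : M.Feasible π)
    (hm : M.UsesPosteriorMeans π) (i : Fin 2) :
    ∀ᵐ ω ∂(M.condH i), ∀ n, M.runLength π ω = n →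
      M.finalEst π i ω = M.postMean n i (M.stat n ω) := by
  refine ae_all_iff.2 fun n => ?_
  by_cases hn : n ≤ M.N
  · filter_upwards [(hm i n hn).trans (M.postMean_ae_eq_condExp hn i).symm] with ω hω hτ
    rw [finalEst_of_runLength_eq hτ]
    exact hω
  · exact ae_of_all _ fun ω h => absurd (h ▸ runLength_le hπ ω) hn

/-- The estimation penalty of a minimizer vanishes, and under `H_i` its coefficient is positive. -/
theorem Minimizes.ae_finalEst_eq {M : Model P 𝒳 T} {C : Fin 4 → ℝ} (hC : 0 ≤ C)
    {π : Policy 𝒳} (h : M.Minimizes C π) {i : Fin 2} (hi : 0 < C (mse i)) :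
    ∀ᵐ ω ∂(M.condH i), ∀ n, M.runLength π ω = n → M.finalDec π ω = i →
      M.finalEst π i ω = M.postMean n i (M.stat n ω) := by
  refine ae_all_iff.2 fun n => ?_
  by_cases hn : n ≤ M.N
  · rw [ae_condH_iff]
    filter_upwards [((excess_eq_zero_iff h.1 hC hn).1 (h.excess_eq_zero hC hn)).1,
      M.ae_postProb_ne_zero hn i] with ω h1 h2 hH hτ hd
    have h3 := (h1 hτ).2.2
    rw [hd, estPenalty, mul_eq_zero, or_iff_right (mul_ne_zero hi.ne' (h2 hH))] at h3
    exact sub_eq_zero.1 (pow_eq_zero_iff two_ne_zero |>.1 h3)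
  · exact ae_of_all _ fun ω hτ => absurd (hτ ▸ runLength_le h.1 ω) hn

/-- Requiring posterior means makes the mean squared errors agree even where the weight is zero and
the objective does not see the estimator. -/
theorem IsOptimalPolicy.expRunLength_eq_errVec_eq {M : Model P 𝒳 T} {C : Fin 4 → ℝ} (hC : 0 ≤ C)
    (hties : M.NoTies C) {π π' : Policy 𝒳} (h : M.IsOptimalPolicy C π)
    (h' : M.IsOptimalPolicy C π') :
    M.expRunLength π = M.expRunLength π' ∧ M.errVec π = M.errVec π' := by
  have hae := h.1.ae_eq hC hties h'.1
  refine ⟨integral_congr_ae (hae.mono fun ω hω => by simp only [hω.1]), ?_⟩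
  refine funext ?_
  refine forall_det_mse (fun i => ?_) (fun i => ?_)
  · rw [errVec_det, errVec_det, errProb_eq_lintegral h.1.1, errProb_eq_lintegral h'.1.1]
    congr 1
    exact lintegral_congr_ae ((M.ae_condH_of_ae i hae).mono fun ω hω => by simp only [hω.2])
  · rw [errVec_mse, errVec_mse, estErr_eq_lintegral h.1.1, estErr_eq_lintegral h'.1.1]
    congr 1
    refine lintegral_congr_ae ?_
    filter_upwards [M.ae_condH_of_ae i hae, h.2.ae_finalEst_eq h.1.1 i,
      h'.2.ae_finalEst_eq h'.1.1 i] with ω h1 h2 h3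
    rw [h1.2, h2 _ h1.1, h3 _ rfl]

theorem meetsConstraints_iff {M : Model P 𝒳 T} {γ : Fin 4 → ℝ} (hγ : 0 ≤ γ) {π : Policy 𝒳}
    (hfin : ∀ i, M.estErr π i ≠ ⊤) : M.MeetsConstraints γ π ↔ ∀ j, M.errVec π j ≤ γ j := by
  have h1 : ∀ i, M.errProb π i ≤ ENNReal.ofReal (γ (det i)) ↔ M.errVec π (det i) ≤ γ (det i) :=
    fun i => by
      rw [errVec_det, ENNReal.le_ofReal_iff_toReal_le (M.errProb_ne_top π i) (hγ _)]
  have h2 : ∀ i, M.estErr π i ≤ ENNReal.ofReal (γ (mse i)) ↔ M.errVec π (mse i) ≤ γ (mse i) :=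
    fun i => by
      rw [errVec_mse, ENNReal.le_ofReal_iff_toReal_le (hfin i) (hγ _)]
  refine ⟨fun h => forall_det_mse (fun i => (h1 i).1 (h i).1) fun i => (h2 i).1 (h i).2,
    fun h i => ⟨(h1 i).2 (h _), (h2 i).2 (h _)⟩⟩

/-- Weak duality. -/
theorem MeetsConstraints.dual_le {M : Model P 𝒳 T} {γ : Fin 4 → ℝ} (hγ : 0 ≤ γ) {π : Policy 𝒳}
    (hπ : M.Feasible π) (h : M.MeetsConstraints γ π) {C : Fin 4 → ℝ} (hC : 0 ≤ C) :
    M.expRunLength π + ∑ j, M.priorVec j * C j * M.errVec π j ≤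
      M.expRunLength π + ∑ j, M.priorVec j * C j * γ j ∧ M.dual γ C ≤ M.expRunLength π := by
  have h1 := (meetsConstraints_iff hγ h.estErr_ne_top).1 h
  have h2 : ∑ j, M.priorVec j * C j * M.errVec π j ≤ ∑ j, M.priorVec j * C j * γ j :=
    Finset.sum_le_sum fun j _ =>
      mul_le_mul_of_nonneg_left (h1 j) (mul_nonneg (M.priorVec_pos j).le (hC j))
  have h3 := rho_le_lagrangian hπ h.estErr_ne_top hC
  rw [dual_eq]
  constructor <;> linarith

end Model

end SeqJoint

end

/-! ### Strong duality and uniqueness -/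

theorem mainTheorem1 {Ω : Type*} [MeasurableSpace Ω] (P : Measure Ω) [IsProbabilityMeasure P]
    {𝒳 : Type*} [MeasurableSpace 𝒳] {T : Type*} [MeasurableSpace T]
    (M : SeqJoint.Model P 𝒳 T) (γ : Fin 4 → ℝ)
    (hγdet : ∀ i, γ (SeqJoint.det i) ∈ Set.Ioo (0 : ℝ) 1)
    (hγmse : ∀ i, 0 < γ (SeqJoint.mse i))
    (C : Fin 4 → ℝ) (hC : 0 ≤ C) (hmax : ∀ C' : Fin 4 → ℝ, 0 ≤ C' → M.dual γ C' ≤ M.dual γ C)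
    (hties : M.NoTies C) :
    (∃ π, M.IsOptimalPolicy C π) ∧
    (∀ π, M.IsOptimalPolicy C π →
      M.SolvesConstrained γ π ∧ M.dual γ C = M.expRunLength π) ∧
    (∀ π π', M.IsOptimalPolicy C π → M.SolvesConstrained γ π' →
      M.Minimizes C π' ∧ M.Agree C π π') := by
  have hγ : 0 ≤ γ := SeqJoint.Model.forall_det_mse (fun i => (hγdet i).1.le) fun i => (hγmse i).le
  have hopt := M.isOptimalPolicy_optPolicy hC
  have hsolve : ∀ π, M.IsOptimalPolicy C π →
      M.SolvesConstrained γ π ∧ M.dual γ C = M.expRunLength π := by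
    intro π hπ
    have hfin := SeqJoint.Model.estErr_ne_top hπ.1.1 hπ.2
    obtain ⟨-, he⟩ := hπ.expRunLength_eq_errVec_eq hC hties hopt
    have hmeets : M.MeetsConstraints γ π :=
      (SeqJoint.Model.meetsConstraints_iff hγ hfin).2 fun j => by
        rw [he]; exact M.errVec_optPolicy_le hC hmax hties j
    have hdual : M.dual γ C = M.expRunLength π := by
      rw [SeqJoint.Model.dual_eq, ← hπ.1.lagrangian_eq hC hfin, he]
      simp only [mul_assoc, M.complementary_slackness hC hmax hties]
      ring
    exact ⟨⟨hπ.1.1, hmeets, fun π' h1 h2 => hdual ▸ (h2.dual_le hγ h1 hC).2⟩, hdual⟩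
  refine ⟨⟨_, hopt⟩, hsolve, fun π π' hπ hπ' => ?_⟩
  obtain ⟨hs, hdual⟩ := hsolve π hπ
  obtain ⟨hf', hm', hmin'⟩ := hπ'
  have hM' : M.Minimizes C π' := by
    rw [SeqJoint.Model.minimizes_iff_lagrangian_le hf' hm'.estErr_ne_top hC]
    -- The constraints bound the Lagrangian of `π'` by `E[τ(π')] + ∑ p_j C_j γ_j`; replacing
    -- `E[τ(π')]` by `E[τ(π)] = L_γ(C)` yields `ρ_0(t_0)`.
    refine ((hm'.dual_le hγ hf' hC).1.trans (add_le_add_left (hmin' π hs.1 hs.2.1) _)).trans ?_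
    rw [← hdual, SeqJoint.Model.dual_eq, sub_add_cancel]
  have hae := hπ.1.ae_eq hC hties hM'
  refine ⟨hM', hae, fun i hi => ?_⟩
  filter_upwards [M.ae_condH_of_ae i hae, hπ.1.ae_finalEst_eq hC hi, hM'.ae_finalEst_eq hC hi]
    with ω h1 h2 h3 hd
  rw [h2 _ h1.1 hd, h3 _ rfl (h1.2 ▸ hd)]
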